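/- There are universal constants $c_\beta>1$ and $\delta_0,c_N,c>0$ such that the following holds. Let $k,N\in\mathbb N$ and $\varepsilon>0$ with $c_\beta\le 1/\varepsilon^2\le k/c_\beta$ and $N\ge c_N/\varepsilon^2$, and let $\delta\le\delta_0$. In the message-passing model there are $k$ sites and a coordinator without input; site $i$ holds a frequency vector $v^i\in\mathbb N^N$, each bit exchanged travels between the coordinator and one specific site, the coordinator produces the output, and all parties may use public and private randomness. Let $F_0(v^1,\dots,v^k)=\bigl|\operatorname{supp}\bigl(\sum_{i=1}^k v^i\bigr)\bigr|$ be the number of distinct elements, and consider any randomized protocol that, on every fixed input $(v^1,\dots,v^k)$ (static setting), outputs with probability at least $1-\delta$ a number $\widetilde W$ with $F_0\le\widetilde W\le(1+\varepsilon)F_0$. Then its communication complexity, i.e. the maximum over all inputs and all outcomes of the randomness of the total number of bits exchanged, is at least $$c\cdot\frac{k}{\varepsilon^2\log_2(\varepsilon^2k)}.$$ -/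

import Mathlib

open MeasureTheory
open scoped ENNReal

/-- One bit travelling on the two-way channel between the coordinator and a site. -/
inductive ChannelEvent where
  /-- a bit sent by the coordinator to the site -/
  | down (b : Bool)
  /-- a bit sent by the site to the coordinator -/
  | up (b : Bool)

/-- The (deterministic) behaviour of the coordinator in the message-passing model with `k` sites.
The coordinator has no input of its own and sees every bit that is exchanged, so it is a decision
tree: depending on the bits seen so far it either stops with an output, or sends one bit to one
specific site, or lets one specific site send one bit. A longer message is a sequence of bits. -/
inductive Coordinator (k : ℕ) (α : Type) : Type where
  | output (a : α) : Coordinator k α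
  | send (i : Fin k) (b : Bool) (next : Coordinator k α) : Coordinator k α
  | receive (i : Fin k) (next : Bool → Coordinator k α) : Coordinator k α

namespace Coordinator

variable {k : ℕ} {α : Type}

/-- Run the protocol. `reply i h` is the bit that site `i` sends when the bits exchanged so far on
its own channel are `h` (in chronological order), and `hist i` is what has been exchanged on the
channel of site `i` before. A message is seen by the coordinator and by the one site on whose channel
it travels only. The result is the output together with the number of bits exchanged. -/
def run (reply : Fin k → List ChannelEvent → Bool) :
    Coordinator k α → (Fin k → List ChannelEvent) → α × ℕ
  | output a, _ => (a, 0)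
  | send i b next, hist =>
      let r := run reply next (Function.update hist i (hist i ++ [ChannelEvent.down b]))
      (r.1, r.2 + 1)
  | receive i next, hist =>
      let b := reply i (hist i)
      let r := run reply (next b) (Function.update hist i (hist i ++ [ChannelEvent.up b]))
      (r.1, r.2 + 1)

end Coordinator

/-- A deterministic protocol in the message-passing model: `k` sites, each holding an input in `X`,
and a coordinator that produces the output in `α`. The bit sent by a site depends only on the input
of this site and on the bits exchanged so far on its own channel. -/
structure DetProtocol (k : ℕ) (X α : Type) where
  coordinator : Coordinator k α
  site : Fin k → X → List ChannelEvent → Bool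

namespace DetProtocol

variable {k : ℕ} {X α : Type}

/-- The output on the input `x`, where site `i` holds `x i`. -/
def out (P : DetProtocol k X α) (x : Fin k → X) : α :=
  (P.coordinator.run (fun i => P.site i (x i)) (fun _ => [])).1

/-- The total number of bits exchanged on the input `x`. -/
def cost (P : DetProtocol k X α) (x : Fin k → X) : ℕ :=
  (P.coordinator.run (fun i => P.site i (x i)) (fun _ => [])).2

end DetProtocol

/-- A randomized protocol in the public coin model: a random string `ω` is drawn from a probability
space, and the parties run a deterministic protocol that may depend on `ω`. Private coins are the
special case in which `ω` has a component for each party which only that party's behaviour uses. -/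
structure RandProtocol (k : ℕ) (X α : Type) where
  Ω : Type
  [mΩ : MeasurableSpace Ω]
  coins : Measure Ω
  [isProb : IsProbabilityMeasure coins]
  det : Ω → DetProtocol k X α

attribute [instance] RandProtocol.mΩ RandProtocol.isProb

namespace RandProtocol

variable {k : ℕ} {X α : Type}

/-- The communication complexity of a randomized protocol: the maximum number of bits exchanged,
over all inputs and all outcomes of the coins (`⊤` if unbounded). -/
noncomputable def commComplexity (P : RandProtocol k X α) : ℕ∞ :=
  ⨆ (ω : P.Ω) (x : Fin k → X), (((P.det ω).cost x : ℕ) : ℕ∞)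

/-- On every input, the probability that the output is not in the set of valid answers for this
input is at most `δ`. -/
def HasError (P : RandProtocol k X α) (valid : (Fin k → X) → Set α) (δ : ℝ) : Prop :=
  ∀ x : Fin k → X, P.coins.real {ω | (P.det ω).out x ∉ valid x} ≤ δ

end RandProtocol

/-- The number of distinct elements `F₀`: site `i` holds the frequency vector `v i` over a universe
of size `N`, and `F₀` is the size of the support of `∑ i, v i`. -/
def distinctElements {k N : ℕ} (v : Fin k → Fin N → ℕ) : ℕ :=
  (Finset.univ.filter fun j : Fin N => (∑ i, v i) j ≠ 0).card

/-- The `(1 + ε)`-approximations of `W`: the numbers `W'` with `W ≤ W' ≤ (1 + ε) W`. -/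
def approximations (ε W : ℝ) : Set ℝ :=
  {W' | W ≤ W' ∧ W' ≤ (1 + ε) * W}

/-- The randomized protocol `P` computes a `(1 + ε)`-approximation to `F₀` with error
probability `δ`. -/
def ComputesF0 {k N : ℕ} (P : RandProtocol k (Fin N → ℕ) ℝ) (ε δ : ℝ) : Prop :=
  P.HasError (fun v => approximations ε (distinctElements v)) δ

/-!
The proof gives the stronger bound `c * k / ε ^ 2`; the logarithm, which is at least `1`, is not
needed.

Take `n ≈ ν / ε ^ 2` elements of the universe, for a small constant `ν`. A random set `y ⊆ [n]` is
encoded by giving its complement to the first site. Each of the other `m = k - 1` sites holds a random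
set `u` disjoint from `y`, so that `(u, y)` is the usual hard distribution of set disjointness on
disjoint pairs, and with a probability `γ` of order `n / m` a uniformly random element is planted into
`u`. Then `F₀` is `n - |y|` plus the number of elements of `y` that are planted somewhere, which is the
number `Z` of planted elements that hit `y`, minus the number of collisions. The number of collisions
has a much smaller variance than `Z` (`collision_variance`, by the Efron-Stein inequality), so that an
approximation of `F₀` determines `Z` up to a small fraction of its standard deviation.

Given `y` and the transcript, the inputs of the sites are independent, because the inputs leading to a
transcript form a box (`Coordinator.finalHist_eq_of_consistent`). A sum of independent indicators
spreads over its standard deviation (`prodExp_anticoncentration`), so the sum of the posterior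
variances of the single hits is, on average, a small fraction of the prior variance of `Z`
(`sum_posteriorVar_le`). For a typical site, the history of its channel together with `y` therefore
tells whether the site hits `y`, with few false positives and few false negatives
(`false_positive_le`, `false_negative_le`).

The channel of one site and the rest of the network form a two-party protocol for set disjointness,
to which the other party may append its guess. For this problem there is a linear lower bound on the
expected length of the transcript under the distribution on disjoint pairs (`disjointness_bound`).
Conditioned on which party owns which element, the two sets are encoded by a uniform point of a cube.
The level-one inequality bounds the total squared Hellinger distance caused by the single coordinates
by the entropy of the transcript, hence by its expected length, and the cut-and-paste property bounds
the effect of planting a common element. Summing over the sites yields a total communication of order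
`m * n`.
-/

/-! ### Channel histories and the box property -/

namespace Coordinator

variable {k : ℕ} {α : Type}

/-- What has been exchanged on each of the channels once the protocol has stopped. -/
def finalHist (reply : Fin k → List ChannelEvent → Bool) :
    Coordinator k α → (Fin k → List ChannelEvent) → Fin k → List ChannelEvent
  | output _, hist => hist
  | send i b next, hist =>
      finalHist reply next (Function.update hist i (hist i ++ [ChannelEvent.down b]))
  | receive i next, hist =>
      finalHist reply (next (reply i (hist i)))
        (Function.update hist i (hist i ++ [ChannelEvent.up (reply i (hist i))]))

lemma prefix_update (hist : Fin k → List ChannelEvent) (i j : Fin k) (e : ChannelEvent) :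
    hist j <+: Function.update hist i (hist i ++ [e]) j := by
  by_cases h : j = i
  · subst h; simp
  · simp [h]

lemma prefix_finalHist (reply : Fin k → List ChannelEvent → Bool) (c : Coordinator k α)
    (hist : Fin k → List ChannelEvent) (j : Fin k) : hist j <+: c.finalHist reply hist j := by
  induction c generalizing hist with
  | output a => exact List.prefix_rfl
  | send i b next ih => exact (prefix_update hist i j _).trans (ih _)
  | receive i next ih => exact (prefix_update hist i j _).trans (ih _ _)

lemma sum_length_update (hist : Fin k → List ChannelEvent) (i : Fin k) (e : ChannelEvent) :
    ∑ j, (Function.update hist i (hist i ++ [e]) j).length = ∑ j, (hist j).length + 1 := by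
  have h : ∀ j, (Function.update hist i (hist i ++ [e]) j).length
      = (hist j).length + if j = i then 1 else 0 := by
    intro j
    by_cases h : j = i
    · subst h; simp
    · simp [h]
  simp [h, Finset.sum_add_distrib]

/-- The number of bits exchanged is the total length of the channel histories. -/
lemma sum_length_finalHist (reply : Fin k → List ChannelEvent → Bool) (c : Coordinator k α)
    (hist : Fin k → List ChannelEvent) :
    ∑ j, (c.finalHist reply hist j).length = ∑ j, (hist j).length + (c.run reply hist).2 := by
  induction c generalizing hist with
  | output a => simp [finalHist, run]
  | send i b next ih => simp only [finalHist, run, ih, sum_length_update]; ring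
  | receive i next ih => simp only [finalHist, run, ih, sum_length_update]; ring

/-- A site that answers according to `ρ` sends exactly the `up` bits recorded in `t` after the
initial part `h`, provided the coordinator's bits are those recorded in `t`. -/
def Consistent (ρ : List ChannelEvent → Bool) (h t : List ChannelEvent) : Prop :=
  ∀ l b, h <+: l → l ++ [ChannelEvent.up b] <+: t → ρ l = b

lemma Consistent.mono {ρ : List ChannelEvent → Bool} {h h' t : List ChannelEvent}
    (H : Consistent ρ h t) (hh : h <+: h') : Consistent ρ h' t :=
  fun l b hl ht => H l b (hh.trans hl) ht

lemma consistent_step {ρ : List ChannelEvent → Bool} {h t : List ChannelEvent} {e : ChannelEvent}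
    (H : Consistent ρ (h ++ [e]) t) (ht : h ++ [e] <+: t)
    (he : ∀ b, e = ChannelEvent.up b → ρ h = b) : Consistent ρ h t := by
  intro l b hl hlt
  rcases Nat.lt_or_ge h.length l.length with hlen | hlen
  · refine H l b ?_ hlt
    refine List.prefix_of_prefix_length_le ht ((List.prefix_append l _).trans hlt) ?_
    simp; omega
  · have hl' : h = l := hl.eq_of_length_le hlen
    subst hl'
    have h2 : h ++ [ChannelEvent.up b] = h ++ [e] := by
      refine (List.prefix_of_prefix_length_le hlt ht ?_).eq_of_length ?_ <;> simp
    simp at h2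
    exact he b h2.symm

lemma consistent_finalHist (reply : Fin k → List ChannelEvent → Bool) (c : Coordinator k α)
    (hist : Fin k → List ChannelEvent) (j : Fin k) :
    Consistent (reply j) (hist j) (c.finalHist reply hist j) := by
  induction c generalizing hist with
  | output a =>
    intro l b hl hlt
    have h1 := hl.length_le
    have h2 := hlt.length_le
    simp [finalHist] at h2
    omega
  | send i b next ih =>
    have h1 := ih (Function.update hist i (hist i ++ [ChannelEvent.down b]))
    have h2 := prefix_finalHist reply next
      (Function.update hist i (hist i ++ [ChannelEvent.down b])) j
    simp only [finalHist]
    by_cases h : j = i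
    · subst h
      rw [Function.update_self] at h1 h2
      exact consistent_step h1 h2 (by simp)
    · rw [Function.update_of_ne h] at h1
      exact h1
  | receive i next ih =>
    have h1 := ih (reply i (hist i))
      (Function.update hist i (hist i ++ [ChannelEvent.up (reply i (hist i))]))
    have h2 := prefix_finalHist reply (next (reply i (hist i)))
      (Function.update hist i (hist i ++ [ChannelEvent.up (reply i (hist i))])) j
    simp only [finalHist]
    by_cases h : j = i
    · subst h
      rw [Function.update_self] at h1 h2
      exact consistent_step h1 h2 (by simp)
    · rw [Function.update_of_ne h] at h1
      exact h1

/-- The rectangle property: if every site is consistent with the channel histories of a run, then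
replacing the behaviour of the sites changes neither these histories nor the output. -/
lemma finalHist_eq_of_consistent (reply reply' : Fin k → List ChannelEvent → Bool)
    (c : Coordinator k α) (hist : Fin k → List ChannelEvent)
    (H : ∀ j, Consistent (reply' j) (hist j) (c.finalHist reply hist j)) :
    c.finalHist reply' hist = c.finalHist reply hist ∧
      (c.run reply' hist).1 = (c.run reply hist).1 := by
  induction c generalizing hist with
  | output a => simp [finalHist, run]
  | send i b next ih =>
    simp only [finalHist, run]
    exact ih _ fun j => (H j).mono (prefix_update hist i j _)
  | receive i next ih =>
    have hb : reply' i (hist i) = reply i (hist i) := by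
      refine H i (hist i) _ List.prefix_rfl ?_
      have := prefix_finalHist reply (next (reply i (hist i)))
        (Function.update hist i (hist i ++ [ChannelEvent.up (reply i (hist i))])) i
      rwa [Function.update_self] at this
    simp only [finalHist, run, hb]
    exact ih _ _ fun j => (H j).mono (prefix_update hist i j _)

end Coordinator

/-- Averaging: a public-coin protocol that errs with probability at most `δ` on every input has an
outcome of the coins for which the error is at most `δ` on average over a finite distribution. -/
lemma exists_average_le {Ω G : Type} [MeasurableSpace Ω] (μ : Measure Ω) [IsProbabilityMeasure μ]
    [Fintype G] (w : G → ℝ) (hw : ∀ g, 0 ≤ w g) (hw1 : ∑ g, w g = 1) (E : G → Set Ω) (δ : ℝ)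
    (hE : ∀ g, μ.real (E g) ≤ δ) :
    ∃ ω, ∑ g, w g * (E g).indicator (fun _ => (1 : ℝ)) ω ≤ δ := by
  -- the events need not be measurable, so they are replaced by measurable hulls
  let E' : G → Set Ω := fun g => toMeasurable μ (E g)
  have hE' : ∀ g, MeasurableSet (E' g) := fun g => measurableSet_toMeasurable _ _
  have hint : ∀ g, Integrable (fun ω => w g * (E' g).indicator (fun _ => (1 : ℝ)) ω) μ :=
    fun g => ((integrable_const 1).indicator (hE' g)).const_mul _
  have hInt : Integrable (fun ω => ∑ g, w g * (E' g).indicator (fun _ => (1 : ℝ)) ω) μ :=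
    integrable_finsetSum _ fun g _ => hint g
  obtain ⟨ω, hω⟩ := exists_le_integral hInt
  refine ⟨ω, ?_⟩
  have h1 : ∑ g, w g * (E g).indicator (fun _ => (1 : ℝ)) ω
      ≤ ∑ g, w g * (E' g).indicator (fun _ => (1 : ℝ)) ω := by
    refine Finset.sum_le_sum fun g _ => mul_le_mul_of_nonneg_left ?_ (hw g)
    exact Set.indicator_le_indicator_of_subset (subset_toMeasurable _ _) (fun _ => zero_le_one) ω
  have h2 : ∫ ω, ∑ g, w g * (E' g).indicator (fun _ => (1 : ℝ)) ω ∂μ ≤ δ := by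
    rw [integral_finsetSum _ fun g _ => hint g]
    calc ∑ g, ∫ ω, w g * (E' g).indicator (fun _ => (1 : ℝ)) ω ∂μ
        = ∑ g, w g * μ.real (E g) := by
          refine Finset.sum_congr rfl fun g _ => ?_
          rw [integral_const_mul, integral_indicator_const _ (hE' g)]
          simp [E', Measure.real, measure_toMeasurable]
      _ ≤ ∑ g, w g * δ := Finset.sum_le_sum fun g _ => mul_le_mul_of_nonneg_left (hE g) (hw g)
      _ = δ := by rw [← Finset.sum_mul, hw1, one_mul]
  exact h1.trans (hω.trans h2)

/-! ### Expectations over finite product spaces -/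

/-- The expectation of `f` under the product of the weights `q i`, on a finite product space. -/
def prodExp {ι S : Type*} [Fintype ι] [DecidableEq ι] [Fintype S] (q : ι → S → ℝ)
    (f : (ι → S) → ℝ) : ℝ :=
  ∑ s, (∏ i, q i (s i)) * f s

section ProdExp

variable {ι S : Type*} [Fintype ι] [DecidableEq ι] [Fintype S] {q : ι → S → ℝ}

lemma prodExp_add (f g : (ι → S) → ℝ) :
    prodExp q (fun s => f s + g s) = prodExp q f + prodExp q g := by
  simp [prodExp, mul_add, Finset.sum_add_distrib]

lemma prodExp_sub (f g : (ι → S) → ℝ) :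
    prodExp q (fun s => f s - g s) = prodExp q f - prodExp q g := by
  simp [prodExp, mul_sub, Finset.sum_sub_distrib]

lemma prodExp_const_mul (c : ℝ) (f : (ι → S) → ℝ) :
    prodExp q (fun s => c * f s) = c * prodExp q f := by
  simp only [prodExp, Finset.mul_sum]
  exact Finset.sum_congr rfl fun s _ => by ring

lemma prodExp_sum {J : Type*} (A : Finset J) (f : J → (ι → S) → ℝ) :
    prodExp q (fun s => ∑ j ∈ A, f j s) = ∑ j ∈ A, prodExp q (f j) := by
  simp only [prodExp, Finset.mul_sum]
  exact Finset.sum_comm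

lemma prodExp_const (hq1 : ∀ i, ∑ a, q i a = 1) (c : ℝ) : prodExp q (fun _ => c) = c := by
  simp only [prodExp]
  rw [← Finset.sum_mul, ← Fintype.prod_sum]
  simp [hq1]

lemma prodExp_mono (hq : ∀ i a, 0 ≤ q i a) {f g : (ι → S) → ℝ}
    (h : ∀ s, (∀ i, q i (s i) ≠ 0) → f s ≤ g s) : prodExp q f ≤ prodExp q g := by
  refine Finset.sum_le_sum fun s _ => ?_
  by_cases hs : ∀ i, q i (s i) ≠ 0
  · exact mul_le_mul_of_nonneg_left (h s hs) (Finset.prod_nonneg fun i _ => hq i _)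
  · push Not at hs
    obtain ⟨i, hi⟩ := hs
    simp [Finset.prod_eq_zero (f := fun i => q i (s i)) (Finset.mem_univ i) hi]

lemma prodExp_congr {f g : (ι → S) → ℝ}
    (h : ∀ s, (∀ i, q i (s i) ≠ 0) → f s = g s) : prodExp q f = prodExp q g := by
  refine Finset.sum_congr rfl fun s _ => ?_
  by_cases hs : ∀ i, q i (s i) ≠ 0
  · rw [h s hs]
  · push Not at hs
    obtain ⟨i, hi⟩ := hs
    simp [Finset.prod_eq_zero (f := fun i => q i (s i)) (Finset.mem_univ i) hi]

lemma prodExp_nonneg (hq : ∀ i a, 0 ≤ q i a) {f : (ι → S) → ℝ}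
    (h : ∀ s, (∀ i, q i (s i) ≠ 0) → 0 ≤ f s) : 0 ≤ prodExp q f := by
  have := prodExp_mono (q := q) hq (f := fun _ => 0) (g := f) h
  simpa [prodExp] using this

/-- Resampling one coordinate does not change the expectation. -/
lemma prodExp_update (hq1 : ∀ i, ∑ a, q i a = 1) (i : ι) (f : (ι → S) → ℝ) :
    ∑ a, q i a * prodExp q (fun s => f (Function.update s i a)) = prodExp q f := by
  -- exchanging the new value with the old one is a weight-preserving involution
  have hinv : Function.Involutive
      (fun p : S × (ι → S) => (p.2 i, Function.update p.2 i p.1)) := by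
    intro p; ext <;> simp
  have hw : ∀ p : S × (ι → S),
      q i (p.2 i) * ∏ j, q j (Function.update p.2 i p.1 j) = q i p.1 * ∏ j, q j (p.2 j) := by
    intro p
    rw [← Finset.mul_prod_erase _ _ (Finset.mem_univ i),
      ← Finset.mul_prod_erase _ (fun j => q j (p.2 j)) (Finset.mem_univ i)]
    have : ∏ j ∈ Finset.univ.erase i, q j (Function.update p.2 i p.1 j)
        = ∏ j ∈ Finset.univ.erase i, q j (p.2 j) :=
      Finset.prod_congr rfl fun j hj => by
        rw [Function.update_of_ne (Finset.ne_of_mem_erase hj)]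
    rw [this]
    simp only [Function.update_self]
    ring
  calc ∑ a, q i a * prodExp q (fun s => f (Function.update s i a))
      = ∑ p : S × (ι → S), q i p.1 * (∏ j, q j (p.2 j)) * f (Function.update p.2 i p.1) := by
        rw [Fintype.sum_prod_type]
        refine Finset.sum_congr rfl fun a _ => ?_
        rw [prodExp, Finset.mul_sum]
        exact Finset.sum_congr rfl fun s _ => by ring
    _ = ∑ p : S × (ι → S), q i p.1 * (∏ j, q j (p.2 j)) * f p.2 := by
        rw [← Equiv.sum_comp hinv.toPerm
          (fun p : S × (ι → S) => q i p.1 * (∏ j, q j (p.2 j)) * f p.2)]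
        refine Finset.sum_congr rfl fun p _ => ?_
        simp only [Function.Involutive.coe_toPerm]
        rw [hw p]
    _ = prodExp q f := by
        rw [Fintype.sum_prod_type]
        simp only [mul_assoc, ← Finset.mul_sum]
        rw [← Finset.sum_mul, hq1, one_mul, prodExp]

lemma prodExp_coord (hq1 : ∀ i, ∑ a, q i a = 1) (i : ι) (g : S → ℝ) :
    prodExp q (fun s => g (s i)) = ∑ a, q i a * g a := by
  rw [← prodExp_update hq1 i]
  simp [prodExp_const hq1]

/-- A factor depending on one coordinate only is independent of a function of the others. -/
lemma prodExp_mul_coord (hq1 : ∀ i, ∑ a, q i a = 1) (i : ι) (f : (ι → S) → ℝ) (g : S → ℝ)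
    (hf : ∀ s a, f (Function.update s i a) = f s) :
    prodExp q (fun s => g (s i) * f s) = (∑ a, q i a * g a) * prodExp q f := by
  rw [← prodExp_update hq1 i]
  simp only [hf, Function.update_self, prodExp_const_mul, Finset.sum_mul]
  exact Finset.sum_congr rfl fun a _ => by ring

/-- The first, second and fourth moments of a sum of independent centred variables that are bounded
by `1`. -/
lemma prodExp_moments (hq : ∀ i a, 0 ≤ q i a) (hq1 : ∀ i, ∑ a, q i a = 1) (r : ι → S → ℝ)
    (hr0 : ∀ i, ∑ a, q i a * r i a = 0) (hr1 : ∀ i a, r i a ^ 2 ≤ 1) (J : Finset ι) :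
    prodExp q (fun s => ∑ i ∈ J, r i (s i)) = 0 ∧
    prodExp q (fun s => (∑ i ∈ J, r i (s i)) ^ 2) = ∑ i ∈ J, ∑ a, q i a * r i a ^ 2 ∧
    prodExp q (fun s => (∑ i ∈ J, r i (s i)) ^ 4) ≤
      3 * (∑ i ∈ J, ∑ a, q i a * r i a ^ 2) ^ 2 + ∑ i ∈ J, ∑ a, q i a * r i a ^ 2 := by
  induction J using Finset.induction_on with
  | empty => simp [prodExp]
  | insert i J hi ih =>
    obtain ⟨h1, h2, h4⟩ := ih
    have hupd : ∀ s a, ∑ j ∈ J, r j (Function.update s i a j) = ∑ j ∈ J, r j (s j) := by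
      intro s a
      refine Finset.sum_congr rfl fun j hj => ?_
      rw [Function.update_of_ne]
      rintro rfl
      exact hi hj
    set V := ∑ j ∈ J, ∑ a, q j a * r j a ^ 2 with hV
    set R : (ι → S) → ℝ := fun s => ∑ j ∈ J, r j (s j) with hR
    set M3 := prodExp q (fun s => R s ^ 3)
    set M4 := prodExp q (fun s => R s ^ 4)
    set v := ∑ a, q i a * r i a ^ 2 with hv
    have hv0 : 0 ≤ v := Finset.sum_nonneg fun a _ => mul_nonneg (hq i a) (sq_nonneg _)
    have hV0 : 0 ≤ V := Finset.sum_nonneg fun j _ =>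
      Finset.sum_nonneg fun a _ => mul_nonneg (hq j a) (sq_nonneg _)
    have hsum : ∀ s, ∑ j ∈ insert i J, r j (s j) = r i (s i) + R s := fun s =>
      Finset.sum_insert hi
    have hRu : ∀ s a, R (Function.update s i a) = R s := hupd
    simp only [hsum, Finset.sum_insert hi]
    refine ⟨?_, ?_, ?_⟩
    · rw [prodExp_add, h1, prodExp_coord hq1 i (r i), hr0, add_zero]
    · have e : ∀ s, (r i (s i) + R s) ^ 2
          = r i (s i) ^ 2 + (2 * (r i (s i) * R s) + R s ^ 2) := fun s => by ring
      simp only [e]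
      rw [prodExp_add, prodExp_add, prodExp_const_mul, prodExp_mul_coord hq1 i R (r i) hRu, h2,
        hr0, prodExp_coord hq1 i (fun a => r i a ^ 2)]
      ring
    · have e : ∀ s, (r i (s i) + R s) ^ 4
          = r i (s i) ^ 4 + (4 * (r i (s i) ^ 3 * R s) + (6 * (r i (s i) ^ 2 * R s ^ 2) +
              (4 * (r i (s i) * R s ^ 3) + R s ^ 4))) := fun s => by ring
      simp only [e]
      rw [prodExp_add, prodExp_add, prodExp_add, prodExp_add, prodExp_const_mul,
        prodExp_const_mul, prodExp_const_mul, prodExp_coord hq1 i (fun a => r i a ^ 4),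
        prodExp_mul_coord hq1 i R (fun a => r i a ^ 3) hRu, h1,
        prodExp_mul_coord hq1 i (fun s => R s ^ 2) (fun a => r i a ^ 2) (by simp [hRu]), h2,
        prodExp_mul_coord hq1 i (fun s => R s ^ 3) (r i) (by simp [hRu]), hr0, ← hv]
      have h5 : ∑ a, q i a * r i a ^ 4 ≤ v := by
        refine Finset.sum_le_sum fun a _ => mul_le_mul_of_nonneg_left ?_ (hq i a)
        nlinarith [hr1 i a, sq_nonneg (r i a)]
      nlinarith [sq_nonneg v]

/-- Anticoncentration: a sum of independent indicators with variance `V ≥ 1` is at distance at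
least `√V / 2` from any given number with probability at least `1 / 64`. -/
lemma prodExp_anticoncentration (hq : ∀ i a, 0 ≤ q i a) (hq1 : ∀ i, ∑ a, q i a = 1)
    (z : S → ℝ) (hz : ∀ a, z a = 0 ∨ z a = 1) (p : ι → ℝ) (hp : ∀ i, p i = ∑ a, q i a * z a)
    (c r : ℝ) (hV1 : 1 ≤ ∑ i, p i * (1 - p i))
    (hV : 4 * r ^ 2 ≤ ∑ i, p i * (1 - p i)) :
    1 / 64 ≤ prodExp q (fun s => if r < |∑ i, z (s i) - c| then 1 else 0) := by
  have hp0 : ∀ i, 0 ≤ p i := fun i => by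
    rw [hp]
    refine Finset.sum_nonneg fun a _ => mul_nonneg (hq i a) ?_
    rcases hz a with h | h <;> simp [h]
  have hp1 : ∀ i, p i ≤ 1 := fun i => by
    rw [hp, ← hq1 i]
    refine Finset.sum_le_sum fun a _ => ?_
    rcases hz a with h | h <;> simp [h, hq i a]
  obtain ⟨h1, h2, h4⟩ := prodExp_moments hq hq1 (fun i a => z a - p i)
    (fun i => by simp [mul_sub, Finset.sum_sub_distrib, ← Finset.sum_mul, hq1, ← hp])
    (fun i a => by
      have := hp0 i
      have := hp1 i
      rcases hz a with h | h <;> rw [h] <;> nlinarith) Finset.univ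
  have hvar : ∀ i, ∑ a, q i a * (z a - p i) ^ 2 = p i * (1 - p i) := by
    intro i
    have e : ∀ a, q i a * (z a - p i) ^ 2
        = (1 - 2 * p i) * (q i a * z a) + p i ^ 2 * q i a := by
      intro a
      rcases hz a with h | h <;> rw [h] <;> ring
    simp only [e, Finset.sum_add_distrib, ← Finset.mul_sum, hq1, ← hp]
    ring
  simp only [hvar] at h2 h4
  set V := ∑ i, p i * (1 - p i) with hVdef
  set R : (ι → S) → ℝ := fun s => ∑ i, (z (s i) - p i) with hR
  set b := c - ∑ i, p i with hb
  have hRb : ∀ s, ∑ i, z (s i) - c = R s - b := by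
    intro s
    simp only [hR, Finset.sum_sub_distrib, hb]
    ring
  set D := V + b ^ 2 with hD
  have hD0 : 0 < D := by positivity
  -- for every `M > 0`, the indicator of `r ^ 2 < f` dominates `2 * g / M - g ^ 2 / M ^ 2`, where
  -- `g = f - r ^ 2`; here `f = (∑ i, z (s i) - c) ^ 2` has mean `D`, and `M = 40 * D`
  have hpt : ∀ s, 2 / (40 * D) * ((R s - b) ^ 2 - r ^ 2)
      - 1 / (40 * D) ^ 2 * (8 * R s ^ 4 + 8 * b ^ 4 - 2 * r ^ 2 * (R s - b) ^ 2 + r ^ 4)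
      ≤ if r < |∑ i, z (s i) - c| then 1 else 0 := by
    intro s
    rw [hRb]
    set g := (R s - b) ^ 2 - r ^ 2 with hg
    have hg2 : g ^ 2 ≤ 8 * R s ^ 4 + 8 * b ^ 4 - 2 * r ^ 2 * (R s - b) ^ 2 + r ^ 4 := by
      have : (R s - b) ^ 4 ≤ 8 * R s ^ 4 + 8 * b ^ 4 := by
        have e1 : (R s - b) ^ 2 ≤ 2 * R s ^ 2 + 2 * b ^ 2 := by nlinarith [sq_nonneg (R s + b)]
        have e2 : ((R s - b) ^ 2) ^ 2 ≤ (2 * R s ^ 2 + 2 * b ^ 2) ^ 2 :=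
          pow_le_pow_left₀ (sq_nonneg _) e1 2
        nlinarith [sq_nonneg (R s ^ 2 - b ^ 2)]
      rw [hg]
      nlinarith
    have hle : 2 / (40 * D) * g
        - 1 / (40 * D) ^ 2 * (8 * R s ^ 4 + 8 * b ^ 4 - 2 * r ^ 2 * (R s - b) ^ 2 + r ^ 4)
        ≤ 2 / (40 * D) * g - 1 / (40 * D) ^ 2 * g ^ 2 := by
      have : 0 ≤ 1 / (40 * D) ^ 2 := by positivity
      nlinarith
    refine hle.trans ?_
    split_ifs with h
    · have : 2 / (40 * D) * g - 1 / (40 * D) ^ 2 * g ^ 2 = 1 - (1 - g / (40 * D)) ^ 2 := by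
        field_simp; ring
      rw [this]
      nlinarith [sq_nonneg (1 - g / (40 * D))]
    · have hg0 : g ≤ 0 := by
        have : (R s - b) ^ 2 ≤ r ^ 2 := sq_le_sq' (by linarith [neg_abs_le (R s - b)])
          ((le_abs_self _).trans (not_lt.mp h))
        linarith
      have e1 : 2 / (40 * D) * g ≤ 0 := mul_nonpos_of_nonneg_of_nonpos (by positivity) hg0
      have e2 : 0 ≤ 1 / (40 * D) ^ 2 * g ^ 2 := by positivity
      linarith
  have hRb2 : prodExp q (fun s => (R s - b) ^ 2) = D := by
    have e : ∀ s, (R s - b) ^ 2 = R s ^ 2 + ((-2 * b) * R s + b ^ 2) := fun s => by ring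
    simp only [e]
    rw [prodExp_add, prodExp_add, prodExp_const_mul, h1, h2, prodExp_const hq1]
    ring
  have hE := prodExp_mono (q := q) hq fun s _ => hpt s
  refine le_trans ?_ hE
  rw [prodExp_sub, prodExp_const_mul, prodExp_const_mul, prodExp_sub, prodExp_add, prodExp_sub,
    prodExp_add, prodExp_const_mul, prodExp_const_mul, prodExp_const hq1, prodExp_const hq1,
    prodExp_const hq1, prodExp_const_mul, hRb2]
  have hr2 : r ^ 2 ≤ D / 4 := by nlinarith [sq_nonneg b]
  have hM4 : 8 * prodExp q (fun s => R s ^ 4) + 8 * b ^ 4 - 2 * r ^ 2 * D + r ^ 4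
      ≤ 32 * D ^ 2 := by
    have e1 : prodExp q (fun s => R s ^ 4) ≤ 4 * V ^ 2 := by nlinarith
    have e2 : r ^ 4 ≤ 2 * r ^ 2 * D := by nlinarith [sq_nonneg r]
    have e3 : V ^ 2 + b ^ 4 ≤ D ^ 2 := by
      rw [hD]; nlinarith [mul_nonneg (by linarith : (0 : ℝ) ≤ V) (sq_nonneg b)]
    nlinarith [sq_nonneg (b ^ 2)]
  have e1 : 2 / (40 * D) * (D - r ^ 2) ≥ 2 / (40 * D) * (3 / 4 * D) :=
    mul_le_mul_of_nonneg_left (by linarith) (by positivity)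
  have e2 : 1 / (40 * D) ^ 2 * (8 * prodExp q (fun s => R s ^ 4) + 8 * b ^ 4 - 2 * r ^ 2 * D + r ^ 4)
      ≤ 1 / (40 * D) ^ 2 * (32 * D ^ 2) := mul_le_mul_of_nonneg_left hM4 (by positivity)
  have e3 : 2 / (40 * D) * (3 / 4 * D) = 3 / 80 := by field_simp; norm_num
  have e4 : 1 / (40 * D) ^ 2 * (32 * D ^ 2) = 1 / 50 := by field_simp; norm_num
  linarith

end ProdExp

lemma prodExp_cons {S : Type*} [Fintype S] {m : ℕ} (q : Fin (m + 1) → S → ℝ)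
    (f : (Fin (m + 1) → S) → ℝ) :
    prodExp q f
      = ∑ a, q 0 a * prodExp (fun i => q i.succ) (fun s => f (Fin.cons a s : Fin (m + 1) → S)) := by
  rw [prodExp, ← (Fin.consEquiv (fun _ => S)).sum_comp, Fintype.sum_prod_type]
  refine Finset.sum_congr rfl fun a _ => ?_
  rw [prodExp, Finset.mul_sum]
  refine Finset.sum_congr rfl fun s _ => ?_
  rw [Fin.prod_univ_succ]
  simp [Fin.consEquiv]
  ring

lemma sum_mul_sub_sq {S : Type*} [Fintype S] (q g : S → ℝ) (hq1 : ∑ a, q a = 1) :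
    ∑ a, q a * (g a - ∑ b, q b * g b) ^ 2 = ∑ a, q a * g a ^ 2 - (∑ a, q a * g a) ^ 2 := by
  set μ := ∑ b, q b * g b with hμ
  have e : ∀ a, q a * (g a - μ) ^ 2 = q a * g a ^ 2 - (2 * μ) * (q a * g a) + μ ^ 2 * q a :=
    fun a => by ring
  simp only [e, Finset.sum_add_distrib, Finset.sum_sub_distrib, ← Finset.mul_sum, hq1, ← hμ]
  ring

/-- The Efron–Stein inequality: the variance of a function of independent variables is at most the
expected sum of the variances in the single coordinates. -/
lemma efron_stein {S : Type*} [Fintype S] {m : ℕ} (q : Fin m → S → ℝ)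
    (hq : ∀ i a, 0 ≤ q i a) (hq1 : ∀ i, ∑ a, q i a = 1) (f : (Fin m → S) → ℝ) :
    prodExp q (fun s => f s ^ 2) - prodExp q f ^ 2 ≤
      ∑ i, prodExp q (fun s => ∑ a, q i a * f (Function.update s i a) ^ 2
        - (∑ a, q i a * f (Function.update s i a)) ^ 2) := by
  induction m with
  | zero => simp [prodExp]
  | succ m ih =>
    set q' : Fin m → S → ℝ := fun i => q i.succ with hq'
    have hq'0 : ∀ i a, 0 ≤ q' i a := fun i a => hq _ a
    have hq'1 : ∀ i, ∑ a, q' i a = 1 := fun i => hq1 _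
    set F : S → (Fin m → S) → ℝ := fun a s => f (Fin.cons a s : Fin (m + 1) → S) with hF
    set φ : (Fin m → S) → ℝ := fun s => ∑ a, q 0 a * F a s with hφ
    set e : S → ℝ := fun a => prodExp q' (F a) with he
    have hsucc : ∑ i : Fin m, prodExp q (fun s => ∑ a, q i.succ a * f (Function.update s i.succ a) ^ 2
          - (∑ a, q i.succ a * f (Function.update s i.succ a)) ^ 2)
        = ∑ a, q 0 a * ∑ i : Fin m, prodExp q' (fun s =>
            ∑ b, q' i b * F a (Function.update s i b) ^ 2
              - (∑ b, q' i b * F a (Function.update s i b)) ^ 2) := by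
      simp only [Finset.mul_sum]
      rw [Finset.sum_comm]
      refine Finset.sum_congr rfl fun i _ => ?_
      rw [prodExp_cons]
      refine Finset.sum_congr rfl fun a _ => ?_
      simp only [← Fin.cons_update, hF, hq']
    have hzero : prodExp q (fun s => ∑ a, q 0 a * f (Function.update s 0 a) ^ 2
          - (∑ a, q 0 a * f (Function.update s 0 a)) ^ 2)
        = prodExp q' (fun s => ∑ a, q 0 a * (F a s - φ s) ^ 2) := by
      rw [prodExp_cons]
      simp only [Fin.update_cons_zero]
      rw [← Finset.sum_mul, hq1, one_mul]
      refine prodExp_congr fun s _ => ?_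
      exact (sum_mul_sub_sq (q 0) (fun a => F a s) (hq1 0)).symm
    have hmean : ∑ a, q 0 a * e a = prodExp q' φ := by
      simp only [he, hφ]
      rw [prodExp_sum]
      exact Finset.sum_congr rfl fun a _ => (prodExp_const_mul _ _).symm
    -- the variance of a conditional expectation, by Jensen's inequality
    have hJ : ∑ a, q 0 a * e a ^ 2 - (∑ a, q 0 a * e a) ^ 2
        ≤ prodExp q' (fun s => ∑ a, q 0 a * (F a s - φ s) ^ 2) := by
      rw [← sum_mul_sub_sq _ _ (hq1 0), prodExp_sum, hmean]
      refine Finset.sum_le_sum fun a _ => ?_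
      rw [prodExp_const_mul]
      refine mul_le_mul_of_nonneg_left ?_ (hq 0 a)
      have h1 : e a - prodExp q' φ = prodExp q' (fun s => F a s - φ s) := by
        rw [prodExp_sub]
      rw [h1]
      set μ := prodExp q' (fun s => F a s - φ s) with hμ
      have h2 : 0 ≤ prodExp q' (fun s => (F a s - φ s - μ) ^ 2) :=
        prodExp_nonneg hq'0 fun s _ => sq_nonneg _
      have h3 : ∀ s, (F a s - φ s - μ) ^ 2
          = (F a s - φ s) ^ 2 - ((2 * μ) * (F a s - φ s) - μ ^ 2) := fun s => by ring
      simp only [h3] at h2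
      rw [prodExp_sub, prodExp_sub, prodExp_const_mul, prodExp_const hq'1, ← hμ] at h2
      nlinarith
    have hIH : ∑ a, q 0 a * (prodExp q' (fun s => F a s ^ 2) - e a ^ 2)
        ≤ ∑ a, q 0 a * ∑ i : Fin m, prodExp q' (fun s =>
            ∑ b, q' i b * F a (Function.update s i b) ^ 2
              - (∑ b, q' i b * F a (Function.update s i b)) ^ 2) :=
      Finset.sum_le_sum fun a _ =>
        mul_le_mul_of_nonneg_left (ih q' hq'0 hq'1 (F a)) (hq 0 a)
    rw [Fin.sum_univ_succ, hsucc, hzero, prodExp_cons, prodExp_cons q f]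
    simp only [mul_sub, Finset.sum_sub_distrib] at hIH ⊢
    change ∑ a, q 0 a * prodExp q' (fun s => F a s ^ 2) - (∑ a, q 0 a * e a) ^ 2 ≤ _
    linarith

/-! ### Posterior variances given a transcript -/

section Posterior

variable {S : Type*} [Fintype S]

open Classical in
/-- The weights `κ` conditioned on the event `c`; all weights are `0` if `c` has probability `0`. -/
noncomputable def posterior (κ : S → ℝ) (c : S → Prop) (a : S) : ℝ :=
  (if c a then κ a else 0) / ∑ b, if c b then κ b else 0

/-- The mean of `z` under the posterior weights. -/
noncomputable def posteriorMean (κ z : S → ℝ) (c : S → Prop) : ℝ :=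
  ∑ a, posterior κ c a * z a

/-- The posterior variance of the indicator `z`. -/
noncomputable def posteriorVar (κ z : S → ℝ) (c : S → Prop) : ℝ :=
  posteriorMean κ z c * (1 - posteriorMean κ z c)

variable {κ z : S → ℝ} {c : S → Prop}

lemma posterior_nonneg (hκ : ∀ a, 0 ≤ κ a) (a : S) : 0 ≤ posterior κ c a := by
  classical
  refine div_nonneg ?_ (Finset.sum_nonneg fun b _ => ?_) <;> split_ifs <;> simp [hκ]

open Classical in
lemma sum_posterior (h : 0 < ∑ b, if c b then κ b else 0) : ∑ a, posterior κ c a = 1 := by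
  simp only [posterior, ← Finset.sum_div]
  exact div_self h.ne'

lemma sum_posterior_le : ∑ a, posterior κ c a ≤ 1 := by
  classical
  simp only [posterior, ← Finset.sum_div]
  exact div_self_le_one _

lemma posteriorMean_nonneg (hκ : ∀ a, 0 ≤ κ a) (hz : ∀ a, z a = 0 ∨ z a = 1) :
    0 ≤ posteriorMean κ z c :=
  Finset.sum_nonneg fun a _ => mul_nonneg (posterior_nonneg hκ a) (by
    rcases hz a with h | h <;> simp [h])

lemma posteriorMean_le_one (hκ : ∀ a, 0 ≤ κ a) (hz : ∀ a, z a = 0 ∨ z a = 1) :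
    posteriorMean κ z c ≤ 1 :=
  (Finset.sum_le_sum fun a _ => mul_le_of_le_one_right (posterior_nonneg hκ a) (by
    rcases hz a with h | h <;> simp [h])).trans sum_posterior_le

lemma posteriorVar_nonneg (hκ : ∀ a, 0 ≤ κ a) (hz : ∀ a, z a = 0 ∨ z a = 1) :
    0 ≤ posteriorVar κ z c :=
  mul_nonneg (posteriorMean_nonneg hκ hz) (by linarith [posteriorMean_le_one (c := c) hκ hz])

variable {ι Θ : Type*} [Fintype ι] [DecidableEq ι]

open Classical in
/-- Independent variables stay independent when conditioned on a transcript whose fibres are boxes.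
To prove an inequality between expectations it is therefore enough to prove it under the product of
the posterior weights, for each transcript. -/
lemma prodExp_nonneg_of_fiber (hκ : ∀ a, 0 ≤ κ a) (full : (ι → S) → Θ)
    (cons : ι → Θ → S → Prop) (h1 : ∀ s i, cons i (full s) (s i))
    (h2 : ∀ s s', (∀ i, cons i (full s) (s' i)) → full s' = full s) (F : Θ → (ι → S) → ℝ)
    (H : ∀ s, (∀ i, 0 < ∑ a, if cons i (full s) a then κ a else 0) →
      0 ≤ prodExp (fun i => posterior κ (cons i (full s))) (F (full s))) :
    0 ≤ prodExp (fun _ => κ) (fun s => F (full s) s) := by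
  rw [prodExp, ← Finset.sum_fiberwise_of_maps_to
    (fun s _ => Finset.mem_image_of_mem full (Finset.mem_univ s))]
  refine Finset.sum_nonneg fun θ hθ => ?_
  obtain ⟨s₀, -, rfl⟩ := Finset.mem_image.mp hθ
  have hbox : ∀ s, full s = full s₀ ↔ ∀ i, cons i (full s₀) (s i) :=
    fun s => ⟨fun h i => h ▸ h1 s i, h2 s₀ s⟩
  have e : ∑ s with full s = full s₀, (∏ i, κ (s i)) * F (full s) s
      = ∑ s : ι → S, (∏ i, if cons i (full s₀) (s i) then κ (s i) else 0) * F (full s₀) s := by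
    rw [Finset.sum_filter]
    refine Finset.sum_congr rfl fun s _ => ?_
    rw [Finset.prod_ite_zero]
    by_cases h : full s = full s₀
    · rw [if_pos h, if_pos (fun i _ => (hbox s).mp h i), h]
    · rw [if_neg h, if_neg (fun h' => h ((hbox s).mpr fun i => h' i (Finset.mem_univ i))), zero_mul]
  rw [e]
  have hQ0 : ∀ i, 0 ≤ ∑ a, if cons i (full s₀) a then κ a else 0 :=
    fun i => Finset.sum_nonneg fun a _ => by split_ifs <;> simp [hκ]
  by_cases hQ : ∀ i, 0 < ∑ a, if cons i (full s₀) a then κ a else 0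
  · have e2 : ∀ s : ι → S, (∏ i, if cons i (full s₀) (s i) then κ (s i) else 0)
        = (∏ i, ∑ a, if cons i (full s₀) a then κ a else 0) *
          ∏ i, posterior κ (cons i (full s₀)) (s i) := by
      intro s
      rw [← Finset.prod_mul_distrib]
      refine Finset.prod_congr rfl fun i _ => ?_
      rw [posterior, mul_div_cancel₀ _ (hQ i).ne']
    simp only [e2, mul_assoc, ← Finset.mul_sum]
    exact mul_nonneg (Finset.prod_nonneg fun i _ => hQ0 i) (H s₀ hQ)
  · push Not at hQ
    obtain ⟨i, hi⟩ := hQ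
    have hi0 := le_antisymm hi (hQ0 i)
    rw [Finset.sum_eq_zero_iff_of_nonneg (fun a _ => by split_ifs <;> simp [hκ])] at hi0
    refine (Finset.sum_eq_zero fun s _ => ?_).ge
    rw [Finset.prod_eq_zero (f := fun i => if cons i (full s₀) (s i) then κ (s i) else 0)
      (Finset.mem_univ i) (hi0 (s i) (Finset.mem_univ _)), zero_mul]

section

variable (hκ : ∀ a, 0 ≤ κ a) (hκ1 : ∑ a, κ a = 1) (hz : ∀ a, z a = 0 ∨ z a = 1)
  (full : (ι → S) → Θ) (cons : ι → Θ → S → Prop) (h1 : ∀ s i, cons i (full s) (s i))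
  (h2 : ∀ s s', (∀ i, cons i (full s) (s' i)) → full s' = full s)

include hκ hz h1 h2

/-- If the indicator `z` is guessed from the transcript by its more likely value, then the probability
of a false positive is at most twice the average posterior variance. -/
lemma false_positive_le (i : ι) :
    prodExp (fun _ : ι => κ) (fun s =>
        (if 1 / 2 < posteriorMean κ z (cons i (full s)) then 1 else 0) * (1 - z (s i)))
      ≤ 2 * prodExp (fun _ : ι => κ) (fun s => posteriorVar κ z (cons i (full s))) := by
  classical
  rw [← sub_nonneg, ← prodExp_const_mul, ← prodExp_sub]
  refine prodExp_nonneg_of_fiber hκ full cons h1 h2 (fun θ s => 2 * posteriorVar κ z (cons i θ) -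
    (if 1 / 2 < posteriorMean κ z (cons i θ) then 1 else 0) * (1 - z (s i))) fun s hs => ?_
  have hs1 : ∀ j, ∑ a, posterior κ (cons j (full s)) a = 1 := fun j => sum_posterior (hs j)
  rw [prodExp_sub, prodExp_const hs1, prodExp_const_mul, prodExp_sub, prodExp_const hs1,
    prodExp_coord hs1 i z, ← posteriorMean]
  have h3 := posteriorMean_le_one (c := cons i (full s)) hκ hz
  have h4 := posteriorVar_nonneg (c := cons i (full s)) hκ hz
  unfold posteriorVar at h4 ⊢
  split_ifs with h <;> nlinarith

/-- If the indicator `z` is guessed from the transcript by its more likely value, then the probability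
of a false negative is at most twice the average posterior variance. -/
lemma false_negative_le (i : ι) :
    prodExp (fun _ : ι => κ) (fun s =>
        (1 - if 1 / 2 < posteriorMean κ z (cons i (full s)) then 1 else 0) * z (s i))
      ≤ 2 * prodExp (fun _ : ι => κ) (fun s => posteriorVar κ z (cons i (full s))) := by
  classical
  rw [← sub_nonneg, ← prodExp_const_mul, ← prodExp_sub]
  refine prodExp_nonneg_of_fiber hκ full cons h1 h2 (fun θ s => 2 * posteriorVar κ z (cons i θ) -
    (1 - if 1 / 2 < posteriorMean κ z (cons i θ) then 1 else 0) * z (s i)) fun s hs => ?_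
  have hs1 : ∀ j, ∑ a, posterior κ (cons j (full s)) a = 1 := fun j => sum_posterior (hs j)
  rw [prodExp_sub, prodExp_const hs1, prodExp_const_mul,
    prodExp_coord hs1 i z, ← posteriorMean]
  have h3 := posteriorMean_nonneg (c := cons i (full s)) hκ hz
  have h4 := posteriorVar_nonneg (c := cons i (full s)) hκ hz
  unfold posteriorVar at h4 ⊢
  split_ifs with h <;> nlinarith

include hκ1

/-- If the transcript determines the sum of the indicators up to an error `r` with high
probability, then the posterior variances are small on average. -/
lemma sum_posteriorVar_le (center : Θ → ℝ) (r Λ η : ℝ) (hr : 1 ≤ 4 * r ^ 2)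
    (hΛ1 : 1 ≤ Λ) (hη : 0 < η) (hΛ : Fintype.card ι * ∑ a, κ a * z a ≤ Λ) :
    prodExp (fun _ : ι => κ) (fun s => ∑ i, posteriorVar κ z (cons i (full s)))
      ≤ 4 * r ^ 2 + 64 * Λ / η * prodExp (fun _ : ι => κ)
          (fun s => if r < |∑ i, z (s i) - center (full s)| then 1 else 0) + 2 * η * Λ := by
  classical
  set V : Θ → ℝ := fun θ => ∑ i, posteriorVar κ z (cons i θ) with hV
  set A : Θ → ℝ := fun θ => if 4 * r ^ 2 ≤ V θ then 1 else 0 with hA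
  have hA0 : ∀ θ, 0 ≤ A θ := fun θ => by simp only [hA]; split_ifs <;> norm_num
  have hA1 : ∀ θ, A θ ≤ 1 := fun θ => by simp only [hA]; split_ifs <;> norm_num
  have hz0 : ∀ a, 0 ≤ z a := fun a => by rcases hz a with h | h <;> simp [h]
  set μ := ∑ a, κ a * z a with hμ
  have hμ0 : 0 ≤ μ := Finset.sum_nonneg fun a _ => mul_nonneg (hκ a) (hz0 a)
  have hμ1 : μ ≤ 1 := by
    rw [← hκ1]
    refine Finset.sum_le_sum fun a _ => mul_le_of_le_one_right (hκ a) ?_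
    rcases hz a with h | h <;> simp [h]
  -- where the posterior variance is large, the error is large with constant probability
  have hPA : prodExp (fun _ : ι => κ) (fun s => A (full s)) ≤
      64 * prodExp (fun _ : ι => κ)
        (fun s => if r < |∑ i, z (s i) - center (full s)| then 1 else 0) := by
    rw [← sub_nonneg, ← prodExp_const_mul, ← prodExp_sub]
    refine prodExp_nonneg_of_fiber hκ full cons h1 h2
      (fun θ s => 64 * (if r < |∑ i, z (s i) - center θ| then 1 else 0) - A θ) fun s hs => ?_
    have hs1 : ∀ j, ∑ a, posterior κ (cons j (full s)) a = 1 := fun j => sum_posterior (hs j)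
    have hp0 : ∀ i a, 0 ≤ posterior κ (cons i (full s)) a := fun i a => posterior_nonneg hκ a
    rw [prodExp_sub, prodExp_const hs1, prodExp_const_mul]
    by_cases hAV : 4 * r ^ 2 ≤ V (full s)
    · have := prodExp_anticoncentration hp0 hs1 z hz
        (fun i => posteriorMean κ z (cons i (full s))) (fun i => rfl) (center (full s)) r
        (hr.trans hAV) hAV
      have := hA1 (full s)
      linarith
    · have h0 : A (full s) = 0 := by simp only [hA]; rw [if_neg hAV]
      rw [h0]
      have := prodExp_nonneg (q := fun i => posterior κ (cons i (full s))) hp0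
        (f := fun t => if r < |∑ i, z (t i) - center (full s)| then 1 else 0)
        (fun t _ => by split_ifs <;> norm_num)
      linarith
  have hVZ : prodExp (fun _ : ι => κ) (fun s => A (full s) * V (full s)) ≤
      prodExp (fun _ : ι => κ) (fun s => A (full s) * ∑ i, z (s i)) := by
    rw [← sub_nonneg, ← prodExp_sub]
    refine prodExp_nonneg_of_fiber hκ full cons h1 h2
      (fun θ s => A θ * ∑ i, z (s i) - A θ * V θ) fun s hs => ?_
    have hs1 : ∀ j, ∑ a, posterior κ (cons j (full s)) a = 1 := fun j => sum_posterior (hs j)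
    rw [prodExp_sub, prodExp_const hs1, prodExp_const_mul, ← mul_sub]
    refine mul_nonneg (hA0 _) ?_
    rw [prodExp_sum, hV, ← Finset.sum_sub_distrib]
    refine Finset.sum_nonneg fun i _ => ?_
    rw [prodExp_coord hs1 i z, ← posteriorMean, posteriorVar]
    nlinarith [sq_nonneg (posteriorMean κ z (cons i (full s)))]
  have hZ2 : prodExp (fun _ : ι => κ) (fun s => (∑ i, z (s i)) ^ 2) ≤ 2 * Λ ^ 2 := by
    obtain ⟨m1, m2, -⟩ := prodExp_moments (ι := ι) (q := fun _ => κ) (fun _ => hκ) (fun _ => hκ1)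
      (fun _ a => z a - μ)
      (fun _ => by simp [mul_sub, Finset.sum_sub_distrib, ← Finset.sum_mul, hκ1, ← hμ])
      (fun _ a => by rcases hz a with h | h <;> rw [h] <;> nlinarith) Finset.univ
    have hvar : ∑ a, κ a * (z a - μ) ^ 2 ≤ μ := by
      rw [hμ, sum_mul_sub_sq κ z hκ1]
      have : ∑ a, κ a * z a ^ 2 = ∑ a, κ a * z a := Finset.sum_congr rfl fun a _ => by
        rcases hz a with h | h <;> simp [h]
      rw [this]
      nlinarith [sq_nonneg (∑ a, κ a * z a)]
    set n : ℝ := (Fintype.card ι : ℝ)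
    have hn : 0 ≤ n := Nat.cast_nonneg _
    have e : ∀ s : ι → S, (∑ i, z (s i)) ^ 2 = (∑ i, (z (s i) - μ)) ^ 2 +
        ((2 * (n * μ)) * (∑ i, (z (s i) - μ)) + (n * μ) ^ 2) := by
      intro s
      simp only [Finset.sum_sub_distrib, Finset.sum_const, Finset.card_univ, nsmul_eq_mul]
      ring
    simp only [e]
    rw [prodExp_add, prodExp_add, prodExp_const_mul, m1, m2, prodExp_const (fun _ => hκ1)]
    simp only [Finset.sum_const, Finset.card_univ, nsmul_eq_mul]
    have h5 : n * ∑ a, κ a * (z a - μ) ^ 2 ≤ n * μ := mul_le_mul_of_nonneg_left hvar hn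
    have h6 : 0 ≤ n * μ := mul_nonneg hn hμ0
    change n * _ + _ ≤ _
    nlinarith
  have hpt : ∀ s : ι → S, V (full s) ≤ 4 * r ^ 2 + A (full s) * V (full s) := by
    intro s
    by_cases hAV : 4 * r ^ 2 ≤ V (full s)
    · simp only [hA]; rw [if_pos hAV]; nlinarith [sq_nonneg r]
    · simp only [hA]; rw [if_neg hAV]; linarith
  have hΛη : 0 < Λ / η := div_pos (by linarith) hη
  have hpt2 : ∀ s : ι → S, A (full s) * ∑ i, z (s i)
      ≤ Λ / η * A (full s) + η / Λ * (∑ i, z (s i)) ^ 2 := by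
    intro s
    set Z := ∑ i, z (s i)
    have hx : η / Λ * (Λ / η) = 1 := by field_simp
    have hxy : 0 ≤ η / Λ := by positivity
    by_cases hAV : 4 * r ^ 2 ≤ V (full s)
    · simp only [hA]; rw [if_pos hAV]
      nlinarith [mul_nonneg hxy (sq_nonneg (Z - Λ / η)), sq_nonneg (Z - Λ / η),
        mul_nonneg hxy (sq_nonneg Z)]
    · simp only [hA]; rw [if_neg hAV]
      nlinarith [mul_nonneg hxy (sq_nonneg Z)]
  have q0 : ∀ (i : ι) (a : S), 0 ≤ (fun _ : ι => κ) i a := fun _ => hκ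
  have a1 := prodExp_mono (q := fun _ : ι => κ) q0 fun s _ => hpt s
  have a2 := prodExp_mono (q := fun _ : ι => κ) q0 fun s _ => hpt2 s
  rw [prodExp_add, prodExp_const (fun _ => hκ1)] at a1
  rw [prodExp_add, prodExp_const_mul, prodExp_const_mul] at a2
  have a3 := mul_le_mul_of_nonneg_left hPA hΛη.le
  have a4 := mul_le_mul_of_nonneg_left hZ2 (by positivity : 0 ≤ η / Λ)
  have a5 : η / Λ * (2 * Λ ^ 2) = 2 * η * Λ := by
    have : Λ ≠ 0 := by linarith
    field_simp
  have a6 : ∀ P : ℝ, Λ / η * (64 * P) = 64 * Λ / η * P := fun P => by ring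
  rw [a6] at a3
  linarith

end

end Posterior

/-! ### Set disjointness -/

/-- The average of `f` over the cube `{0, 1}ⁿ`. -/
noncomputable def cubeExp {n : ℕ} (f : (Fin n → Bool) → ℝ) : ℝ :=
  prodExp (fun (_ : Fin n) (_ : Bool) => (1 / 2 : ℝ)) f

section Cube

variable {n : ℕ}

lemma sum_half (_ : Fin n) : ∑ _a : Bool, (1 / 2 : ℝ) = 1 := by norm_num

lemma cubeExp_add (f g : (Fin n → Bool) → ℝ) :
    cubeExp (fun v => f v + g v) = cubeExp f + cubeExp g := prodExp_add f g

lemma cubeExp_sub (f g : (Fin n → Bool) → ℝ) :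
    cubeExp (fun v => f v - g v) = cubeExp f - cubeExp g := prodExp_sub f g

lemma cubeExp_const_mul (c : ℝ) (f : (Fin n → Bool) → ℝ) :
    cubeExp (fun v => c * f v) = c * cubeExp f := prodExp_const_mul c f

lemma cubeExp_sum {J : Type*} (A : Finset J) (f : J → (Fin n → Bool) → ℝ) :
    cubeExp (fun v => ∑ j ∈ A, f j v) = ∑ j ∈ A, cubeExp (f j) := prodExp_sum A f

lemma cubeExp_const (c : ℝ) : cubeExp (fun _ : Fin n → Bool => c) = c := prodExp_const sum_half c

lemma cubeExp_mono {f g : (Fin n → Bool) → ℝ} (h : ∀ v, f v ≤ g v) : cubeExp f ≤ cubeExp g :=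
  prodExp_mono (fun _ _ => by norm_num) fun v _ => h v

lemma cubeExp_nonneg {f : (Fin n → Bool) → ℝ} (h : ∀ v, 0 ≤ f v) : 0 ≤ cubeExp f :=
  prodExp_nonneg (fun _ _ => by norm_num) fun v _ => h v

lemma cubeExp_eq_half (j : Fin n) (f : (Fin n → Bool) → ℝ) :
    cubeExp f = 1 / 2 * (cubeExp (fun v => f (Function.update v j true)) +
      cubeExp (fun v => f (Function.update v j false))) := by
  have := prodExp_update sum_half j f
  rw [Fintype.sum_bool] at this
  rw [cubeExp, ← this]
  simp only [cubeExp]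
  ring

/-- A bit as a sign; `boolSign (v j)` is the character of the `j`-th coordinate of the cube. -/
noncomputable def boolSign (b : Bool) : ℝ := if b then 1 else -1

/-- The level-one inequality: if `g ≤ 1` has mean `λ > 0`, then the biases of the coordinates under
the density `g / λ` have total square at most `2 log (1 / λ)`. -/
lemma level_one (g : (Fin n → Bool) → ℝ) (h0 : ∀ v, 0 ≤ g v) (h1 : ∀ v, g v ≤ 1)
    (hl : 0 < cubeExp g) :
    ∑ j, (cubeExp (fun v => g v * boolSign (v j)) / cubeExp g) ^ 2
      ≤ 2 * -Real.log (cubeExp g) := by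
  set l := cubeExp g with hlam
  set b : Fin n → ℝ := fun j => cubeExp (fun v => g v * boolSign (v j)) / l with hb
  set B := ∑ j, b j ^ 2 with hB
  -- the exponential moment of `∑ j, b j χ j` is at least `l * exp B` under `g`, by convexity,
  -- and at most `exp (B / 2)` under the uniform weights
  have hup : cubeExp (fun v => Real.exp (∑ j, b j * boolSign (v j))) ≤ Real.exp (B / 2) := by
    have e : ∀ v : Fin n → Bool, (∏ _j : Fin n, (1 / 2 : ℝ)) *
        Real.exp (∑ j, b j * boolSign (v j)) = ∏ j, (1 / 2) * Real.exp (b j * boolSign (v j)) := by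
      intro v
      rw [Real.exp_sum, Finset.prod_mul_distrib]
    rw [cubeExp, prodExp]
    simp only [e]
    rw [← Fintype.prod_sum (fun j a => 1 / 2 * Real.exp (b j * boolSign a)), hB, Finset.sum_div,
      Real.exp_sum]
    refine Finset.prod_le_prod (fun j _ => Finset.sum_nonneg fun a _ => by positivity)
      fun j _ => ?_
    refine le_trans (le_of_eq ?_) (Real.cosh_le_exp_half_sq (b j))
    rw [Fintype.sum_bool, Real.cosh_eq]
    simp [boolSign]
    ring
  have hlow : l * Real.exp B ≤ cubeExp (fun v => Real.exp (∑ j, b j * boolSign (v j))) := by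
    have hpt : ∀ v, Real.exp B * (∑ j, b j * (g v * boolSign (v j)) + (1 - B) * g v)
        ≤ Real.exp (∑ j, b j * boolSign (v j)) := by
      intro v
      set ℓ := ∑ j, b j * boolSign (v j) with hℓ
      have e1 : ∑ j, b j * (g v * boolSign (v j)) = g v * ℓ := by
        rw [hℓ, Finset.mul_sum]
        exact Finset.sum_congr rfl fun j _ => by ring
      have e2 : Real.exp B * (ℓ - B + 1) ≤ Real.exp ℓ := by
        have := Real.add_one_le_exp (ℓ - B)
        calc Real.exp B * (ℓ - B + 1) ≤ Real.exp B * Real.exp (ℓ - B) :=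
              mul_le_mul_of_nonneg_left this (Real.exp_pos _).le
          _ = Real.exp ℓ := by rw [← Real.exp_add]; ring_nf
      calc Real.exp B * (∑ j, b j * (g v * boolSign (v j)) + (1 - B) * g v)
          = g v * (Real.exp B * (ℓ - B + 1)) := by rw [e1]; ring
        _ ≤ g v * Real.exp ℓ := mul_le_mul_of_nonneg_left e2 (h0 v)
        _ ≤ Real.exp ℓ := mul_le_of_le_one_left (Real.exp_pos _).le (h1 v)
    have := cubeExp_mono hpt
    rw [cubeExp_const_mul, cubeExp_add, cubeExp_const_mul, cubeExp_sum] at this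
    have e3 : ∑ j, cubeExp (fun v => b j * (g v * boolSign (v j))) = l * B := by
      rw [hB, Finset.mul_sum]
      refine Finset.sum_congr rfl fun j _ => ?_
      rw [cubeExp_const_mul]
      have : cubeExp (fun v => g v * boolSign (v j)) = l * b j := by
        simp only [hb]
        rw [mul_div_cancel₀ _ hl.ne']
      rw [this]
      ring
    rw [e3] at this
    linarith
  have h3 : Real.exp (Real.log l + B) ≤ Real.exp (B / 2) := by
    rw [Real.exp_add, Real.exp_log hl]
    exact hlow.trans hup
  have := Real.exp_le_exp.mp h3
  linarith

lemma sqrt_sub_sqrt_sq_mul_le {x y : ℝ} (hx : 0 ≤ x) (hy : 0 ≤ y) :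
    (√x - √y) ^ 2 * (x + y) ≤ (x - y) ^ 2 := by
  have e : (x - y) ^ 2 = (√x - √y) ^ 2 * (√x + √y) ^ 2 := by
    rw [← mul_pow, mul_comm, ← sq_sub_sq, Real.sq_sqrt hx, Real.sq_sqrt hy]
  rw [e]
  refine mul_le_mul_of_nonneg_left ?_ (sq_nonneg _)
  nlinarith [Real.sq_sqrt hx, Real.sq_sqrt hy, mul_nonneg (Real.sqrt_nonneg x) (Real.sqrt_nonneg y)]

/-- The squared Hellinger distances caused by the single coordinates add up to at most the entropy
term of `cubeExp g`. -/
lemma sum_hellinger_le_negMulLog (g : (Fin n → Bool) → ℝ) (h0 : ∀ v, 0 ≤ g v)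
    (h1 : ∀ v, g v ≤ 1) :
    ∑ j, (√(cubeExp fun v => g (Function.update v j true)) -
        √(cubeExp fun v => g (Function.update v j false))) ^ 2
      ≤ 4 * Real.negMulLog (cubeExp g) := by
  set l := cubeExp g with hlam
  have hp : ∀ j c, 0 ≤ cubeExp fun v => g (Function.update v j c) :=
    fun j c => cubeExp_nonneg fun v => h0 _
  have hsum : ∀ j, (cubeExp fun v => g (Function.update v j true)) +
      (cubeExp fun v => g (Function.update v j false)) = 2 * l := by
    intro j
    rw [hlam, cubeExp_eq_half j g]
    ring
  rcases (cubeExp_nonneg h0).eq_or_lt with hl | hl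
  · have hz : ∀ j c, (cubeExp fun v => g (Function.update v j c)) = 0 := by
      intro j c
      have a1 := hp j true
      have a2 := hp j false
      have a3 := hsum j
      rw [hlam, ← hl] at a3
      cases c <;> linarith
    simp [hz, hlam, ← hl]
  · have hdiff : ∀ j, (cubeExp fun v => g (Function.update v j true)) -
        (cubeExp fun v => g (Function.update v j false))
          = 2 * cubeExp (fun v => g v * boolSign (v j)) := by
      intro j
      rw [cubeExp_eq_half j (fun v => g v * boolSign (v j))]
      have e : ∀ v : Fin n → Bool, g (Function.update v j false) * boolSign false
          = (-1) * g (Function.update v j false) := fun v => by simp [boolSign]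
      have e' : ∀ v : Fin n → Bool, g (Function.update v j true) * boolSign true
          = g (Function.update v j true) := fun v => by simp [boolSign]
      simp only [Function.update_self, e, e', cubeExp_const_mul]
      ring
    have hj : ∀ j, (√(cubeExp fun v => g (Function.update v j true)) -
        √(cubeExp fun v => g (Function.update v j false))) ^ 2
          ≤ 2 * l * (cubeExp (fun v => g v * boolSign (v j)) / l) ^ 2 := by
      intro j
      have := sqrt_sub_sqrt_sq_mul_le (hp j true) (hp j false)
      rw [hsum, hdiff] at this
      have hl' : 0 < 2 * l := by linarith
      have e : 2 * l * (cubeExp (fun v => g v * boolSign (v j)) / l) ^ 2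
          = (2 * cubeExp (fun v => g v * boolSign (v j))) ^ 2 / (2 * l) := by
        field_simp
      rw [e, le_div_iff₀ hl']
      exact this
    calc _ ≤ ∑ j, 2 * l * (cubeExp (fun v => g v * boolSign (v j)) / l) ^ 2 :=
          Finset.sum_le_sum fun j _ => hj j
      _ = 2 * l * ∑ j, (cubeExp (fun v => g v * boolSign (v j)) / l) ^ 2 := by
          rw [Finset.mul_sum]
      _ ≤ 2 * l * (2 * -Real.log l) :=
          mul_le_mul_of_nonneg_left (level_one g h0 h1 hl) (by linarith)
      _ = 4 * Real.negMulLog l := by rw [Real.negMulLog]; ring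

/-- Gibbs' inequality: the entropy of a distribution is at most its expected codeword length `c`,
for any lengths that satisfy Kraft's inequality. -/
lemma sum_negMulLog_le {T : Type*} [Fintype T] (p c : T → ℝ) (hp : ∀ t, 0 ≤ p t)
    (hp1 : ∑ t, p t = 1) (hc : ∑ t, Real.exp (-c t) ≤ 1) :
    ∑ t, Real.negMulLog (p t) ≤ ∑ t, p t * c t := by
  have h : ∀ t, Real.negMulLog (p t) ≤ p t * c t + (Real.exp (-c t) - p t) := by
    intro t
    rcases (hp t).eq_or_lt with h | h
    · rw [← h]; simp [(Real.exp_pos _).le]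
    · have h1 := Real.log_le_sub_one_of_pos (div_pos (Real.exp_pos (-c t)) h)
      rw [Real.log_div (Real.exp_pos _).ne' h.ne', Real.log_exp] at h1
      have h2 := mul_le_mul_of_nonneg_left h1 h.le
      have h3 : p t * (Real.exp (-c t) / p t - 1) = Real.exp (-c t) - p t := by
        field_simp
      rw [h3] at h2
      rw [Real.negMulLog]
      nlinarith
  calc _ ≤ ∑ t, (p t * c t + (Real.exp (-c t) - p t)) := Finset.sum_le_sum fun t _ => h t
    _ = ∑ t, p t * c t + (∑ t, Real.exp (-c t) - 1) := by
        rw [Finset.sum_add_distrib, Finset.sum_sub_distrib, hp1]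
    _ ≤ _ := by linarith

/-- The set of the first party in a random pair of disjoint sets: `d` says which party owns each
element, and `v` which elements are present. -/
def firstSet (d v : Fin n → Bool) : Fin n → Bool := fun j => d j && v j

/-- The set of the second party in a random pair of disjoint sets. -/
def secondSet (d v : Fin n → Bool) : Fin n → Bool := fun j => !d j && v j

lemma cubeExp_mul_split (d : Fin n → Bool) (f g : (Fin n → Bool) → ℝ) :
    cubeExp (fun v => f (firstSet d v) * g (secondSet d v))
      = cubeExp (fun v => f (firstSet d v)) * cubeExp (fun v => g (secondSet d v)) := by
  -- exchanging `v` and `v'` outside of `d` makes `v` carry both arguments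
  have hinv : Function.Involutive (fun p : (Fin n → Bool) × (Fin n → Bool) =>
      ((fun j => if d j then p.1 j else p.2 j : Fin n → Bool),
        (fun j => if d j then p.2 j else p.1 j : Fin n → Bool))) := by
    intro p
    ext j <;> by_cases h : d j <;> simp [h]
  set w : ℝ := ∏ _j : Fin n, (1 / 2 : ℝ) with hw
  have hw1 : ∑ _v : Fin n → Bool, w = 1 := by
    have : ∑ _v : Fin n → Bool, w * 1 = 1 := cubeExp_const 1
    simpa only [mul_one] using this
  have e1 : cubeExp (fun v => f (firstSet d v)) * cubeExp (fun v => g (secondSet d v))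
      = ∑ p : (Fin n → Bool) × (Fin n → Bool),
          w * (w * (f (firstSet d p.1) * g (secondSet d p.2))) := by
    rw [Fintype.sum_prod_type, cubeExp, cubeExp, prodExp, prodExp, Finset.sum_mul_sum]
    exact Finset.sum_congr rfl fun v _ => Finset.sum_congr rfl fun v' _ => by ring
  have e2 : cubeExp (fun v => f (firstSet d v) * g (secondSet d v))
      = ∑ p : (Fin n → Bool) × (Fin n → Bool),
          w * (w * (f (firstSet d p.1) * g (secondSet d p.1))) := by
    rw [Fintype.sum_prod_type, cubeExp, prodExp]
    refine Finset.sum_congr rfl fun v _ => ?_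
    dsimp only
    rw [← Finset.sum_mul, hw1, one_mul]
  rw [e1, e2, ← Equiv.sum_comp (Function.Involutive.toPerm _ hinv)
    (fun p => w * (w * (f (firstSet d p.1) * g (secondSet d p.1))))]
  refine Finset.sum_congr rfl fun p _ => ?_
  have a1 : firstSet d (Function.Involutive.toPerm _ hinv p).1 = firstSet d p.1 := by
    ext j; by_cases h : d j <;> simp [firstSet, h]
  have a2 : secondSet d (Function.Involutive.toPerm _ hinv p).1 = secondSet d p.2 := by
    ext j; by_cases h : d j <;> simp [secondSet, h]
  rw [a1, a2]

/-- The squared Hellinger distance of two finite measures. -/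
noncomputable def hellinger {T : Type*} [Fintype T] (p q : T → ℝ) : ℝ := ∑ t, (√(p t) - √(q t)) ^ 2

lemma hellinger_triangle {T : Type*} [Fintype T] (p q r : T → ℝ) :
    hellinger q r ≤ 2 * hellinger p q + 2 * hellinger p r := by
  simp only [hellinger, Finset.mul_sum, ← Finset.sum_add_distrib]
  refine Finset.sum_le_sum fun t _ => ?_
  nlinarith [sq_nonneg ((√(p t) - √(q t)) + (√(p t) - √(r t)))]

/-- The cut-and-paste property of product kernels. -/
lemma hellinger_cut_paste {T : Type*} [Fintype T] (A B : Bool → T → ℝ) (hA : ∀ a t, 0 ≤ A a t)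
    (hB : ∀ b t, 0 ≤ B b t) (h1 : ∀ a b, ∑ t, A a t * B b t = 1) :
    hellinger (fun t => A false t * B false t) (fun t => A true t * B true t)
      = hellinger (fun t => A true t * B false t) (fun t => A false t * B true t) := by
  have e : ∀ a b t, (√(A a t * B b t) - √(A (!a) t * B (!b) t)) ^ 2
      = A a t * B b t + A (!a) t * B (!b) t
        - 2 * √(A false t * B false t * (A true t * B true t)) := by
    intro a b t
    have hp : ∀ a b, 0 ≤ A a t * B b t := fun a b => mul_nonneg (hA a t) (hB b t)
    rw [sub_sq, Real.sq_sqrt (hp a b), Real.sq_sqrt (hp (!a) (!b)), mul_assoc,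
      ← Real.sqrt_mul (hp a b)]
    have : A a t * B b t * (A (!a) t * B (!b) t)
        = A false t * B false t * (A true t * B true t) := by
      cases a <;> cases b <;> simp <;> ring
    rw [this]
    ring
  have e1 := fun t => e false false t
  have e2 := fun t => e true false t
  simp only [Bool.not_false, Bool.not_true] at e1 e2
  simp only [hellinger, e1, e2, Finset.sum_sub_distrib, Finset.sum_add_distrib, h1]

/-- The Hellinger distance bounds the difference of two expectations. -/
lemma sum_mul_sub_le_hellinger {T : Type*} [Fintype T] (p q φ : T → ℝ) (hp : ∀ t, 0 ≤ p t)
    (hq : ∀ t, 0 ≤ q t) (hp1 : ∑ t, p t = 1) (hq1 : ∑ t, q t = 1) (h0 : ∀ t, 0 ≤ φ t)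
    (h1 : ∀ t, φ t ≤ 1) :
    ∑ t, φ t * q t - ∑ t, φ t * p t ≤ 2 * hellinger p q + 1 / 2 := by
  have h : ∀ t, φ t * q t - φ t * p t ≤ 2 * (√(p t) - √(q t)) ^ 2 + 1 / 4 * (p t + q t) := by
    intro t
    have hx := Real.sq_sqrt (hp t)
    have hy := Real.sq_sqrt (hq t)
    set x := √(p t)
    set y := √(q t)
    have hR : 0 ≤ 2 * (x - y) ^ 2 + 1 / 4 * (p t + q t) := by
      have := hp t; have := hq t; positivity
    have hqp : q t - p t ≤ 2 * (x - y) ^ 2 + 1 / 4 * (p t + q t) := by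
      rw [← hx, ← hy]
      -- `(y - x) (y + x) ≤ 2 (y - x) ^ 2 + (y + x) ^ 2 / 8`
      nlinarith [sq_nonneg (4 * (y - x) - (y + x)), sq_nonneg (x - y)]
    nlinarith [h0 t, h1 t]
  calc ∑ t, φ t * q t - ∑ t, φ t * p t = ∑ t, (φ t * q t - φ t * p t) := by
        rw [Finset.sum_sub_distrib]
    _ ≤ ∑ t, (2 * (√(p t) - √(q t)) ^ 2 + 1 / 4 * (p t + q t)) :=
        Finset.sum_le_sum fun t _ => h t
    _ = 2 * hellinger p q + 1 / 2 := by
        rw [Finset.sum_add_distrib, ← Finset.mul_sum, ← Finset.mul_sum, Finset.sum_add_distrib,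
          hp1, hq1, hellinger]
        norm_num

lemma firstSet_update_true (d v : Fin n → Bool) (j : Fin n) (a : Bool) :
    firstSet (Function.update d j true) (Function.update v j a)
      = Function.update (firstSet d v) j a := by
  ext i; by_cases h : i = j
  · subst h; simp [firstSet]
  · simp [firstSet, h]

lemma secondSet_update_true (d v : Fin n → Bool) (j : Fin n) (a : Bool) :
    secondSet (Function.update d j true) (Function.update v j a)
      = Function.update (secondSet d v) j false := by
  ext i; by_cases h : i = j
  · subst h; simp [secondSet]
  · simp [secondSet, h]

lemma firstSet_update_false (d v : Fin n → Bool) (j : Fin n) (a : Bool) :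
    firstSet (Function.update d j false) (Function.update v j a)
      = Function.update (firstSet d v) j false := by
  ext i; by_cases h : i = j
  · subst h; simp [firstSet]
  · simp [firstSet, h]

lemma secondSet_update_false (d v : Fin n → Bool) (j : Fin n) (a : Bool) :
    secondSet (Function.update d j false) (Function.update v j a)
      = Function.update (secondSet d v) j a := by
  ext i; by_cases h : i = j
  · subst h; simp [secondSet]
  · simp [secondSet, h]

lemma firstSet_update_right (d v : Fin n → Bool) (j : Fin n) :
    firstSet d (Function.update v j false) = Function.update (firstSet d v) j false := by
  ext i; by_cases h : i = j
  · subst h; simp [firstSet]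
  · simp [firstSet, h]

lemma secondSet_update_right (d v : Fin n → Bool) (j : Fin n) :
    secondSet d (Function.update v j false) = Function.update (secondSet d v) j false := by
  ext i; by_cases h : i = j
  · subst h; simp [secondSet]
  · simp [secondSet, h]

/-- The lower bound for set disjointness. The transcript `t` of a two-party protocol has probability
`α t x * β t y` on the inputs `x` and `y`, and `φ t` is the probability with which `t` is answered by
"intersecting". If planting a common element into a random pair of disjoint sets raises the
probability of this answer substantially, then the expected codeword length `c` of the transcript is
linear in `n`. -/
lemma disjointness_bound {T : Type*} [Fintype T] (α β : T → (Fin n → Bool) → ℝ)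
    (hα : ∀ t x, 0 ≤ α t x) (hβ : ∀ t y, 0 ≤ β t y) (h1 : ∀ x y, ∑ t, α t x * β t y = 1)
    (φ c : T → ℝ) (hφ0 : ∀ t, 0 ≤ φ t) (hφ1 : ∀ t, φ t ≤ 1)
    (hc : ∑ t, Real.exp (-c t) ≤ 1) :
    cubeExp (fun d => cubeExp fun v => ∑ j, ∑ t, φ t *
        (α t (Function.update (firstSet d v) j true) *
          β t (Function.update (secondSet d v) j true)))
      ≤ n / 2 + 2 * n * cubeExp (fun d => cubeExp fun v =>
          ∑ t, φ t * (α t (firstSet d v) * β t (secondSet d v)))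
        + 32 * cubeExp (fun d => cubeExp fun v =>
          ∑ t, c t * (α t (firstSet d v) * β t (secondSet d v))) := by
  set A : (Fin n → Bool) → Fin n → Bool → T → ℝ :=
    fun d j a t => cubeExp fun v => α t (Function.update (firstSet d v) j a) with hA
  set B : (Fin n → Bool) → Fin n → Bool → T → ℝ :=
    fun d j b t => cubeExp fun v => β t (Function.update (secondSet d v) j b) with hB
  have hK : ∀ d j a b t, (cubeExp fun v => α t (Function.update (firstSet d v) j a) *
      β t (Function.update (secondSet d v) j b)) = A d j a t * B d j b t :=
    fun d j a b t => cubeExp_mul_split d (fun x => α t (Function.update x j a))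
      (fun y => β t (Function.update y j b))
  have hA0 : ∀ d j a t, 0 ≤ A d j a t := fun d j a t => cubeExp_nonneg fun v => hα _ _
  have hB0 : ∀ d j a t, 0 ≤ B d j a t := fun d j a t => cubeExp_nonneg fun v => hβ _ _
  have hAB1 : ∀ d j a b, ∑ t, A d j a t * B d j b t = 1 := by
    intro d j a b
    simp only [← hK]
    rw [← cubeExp_sum]
    simp only [h1]
    exact cubeExp_const 1
  set G : (Fin n → Bool) → T → (Fin n → Bool) → ℝ :=
    fun d t v => α t (firstSet d v) * β t (secondSet d v) with hG
  have hG0 : ∀ d t v, 0 ≤ G d t v := fun d t v => mul_nonneg (hα _ _) (hβ _ _)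
  have hG1 : ∀ d t v, G d t v ≤ 1 := fun d t v => by
    rw [← h1 (firstSet d v) (secondSet d v)]
    exact Finset.single_le_sum (f := fun t => α t (firstSet d v) * β t (secondSet d v))
      (fun t _ => hG0 d t v) (Finset.mem_univ t)
  -- the information about coordinate `j` revealed by the transcript
  set I : Fin n → (Fin n → Bool) → ℝ := fun j d =>
    hellinger (fun t => cubeExp fun v => G d t (Function.update v j true))
      (fun t => cubeExp fun v => G d t (Function.update v j false)) with hI
  have hIsum : ∀ d, ∑ j, I j d ≤ 4 * cubeExp (fun v => ∑ t, c t * G d t v) := by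
    intro d
    simp only [hI, hellinger]
    rw [Finset.sum_comm]
    calc _ ≤ ∑ t, 4 * Real.negMulLog (cubeExp (G d t)) :=
          Finset.sum_le_sum fun t _ => sum_hellinger_le_negMulLog (G d t) (hG0 d t) (hG1 d t)
      _ = 4 * ∑ t, Real.negMulLog (cubeExp (G d t)) := by rw [Finset.mul_sum]
      _ ≤ 4 * ∑ t, cubeExp (G d t) * c t := by
          refine mul_le_mul_of_nonneg_left ?_ (by norm_num)
          refine sum_negMulLog_le _ c (fun t => cubeExp_nonneg (hG0 d t)) ?_ hc
          rw [← cubeExp_sum]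
          simp only [hG, h1]
          exact cubeExp_const 1
      _ = 4 * cubeExp (fun v => ∑ t, c t * G d t v) := by
          rw [cubeExp_sum]
          simp only [cubeExp_const_mul, mul_comm]
  have hIt : ∀ j d, I j (Function.update d j true) =
      hellinger (fun t => A d j true t * B d j false t) (fun t => A d j false t * B d j false t) := by
    intro j d
    simp only [hI, hG, firstSet_update_true, secondSet_update_true, hK]
  have hIf : ∀ j d, I j (Function.update d j false) =
      hellinger (fun t => A d j false t * B d j true t) (fun t => A d j false t * B d j false t) := by
    intro j d
    simp only [hI, hG, firstSet_update_false, secondSet_update_false, hK]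
  have hcomm : ∀ p q : T → ℝ, hellinger p q = hellinger q p := fun p q =>
    Finset.sum_congr rfl fun t _ => by ring
  set H : Fin n → (Fin n → Bool) → ℝ := fun j d =>
    hellinger (fun t => A d j false t * B d j false t) (fun t => A d j true t * B d j true t)
    with hH
  have hHI : ∀ j, cubeExp (H j) ≤ 4 * cubeExp (I j) := by
    intro j
    have hpt : ∀ d, H j d ≤ 2 * (I j (Function.update d j true) + I j (Function.update d j false)) := by
      intro d
      simp only [hH]
      rw [hellinger_cut_paste _ _ (hA0 d j) (hB0 d j) (hAB1 d j), hIt, hIf]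
      have := hellinger_triangle (fun t => A d j false t * B d j false t)
        (fun t => A d j true t * B d j false t) (fun t => A d j false t * B d j true t)
      rw [hcomm (fun t => A d j false t * B d j false t), hcomm (fun t => A d j false t * B d j false t)
        (fun t => A d j false t * B d j true t)] at this
      linarith
    have := cubeExp_mono hpt
    rw [cubeExp_const_mul, cubeExp_add] at this
    rw [cubeExp_eq_half j (I j)]
    linarith
  have hφK : ∀ d j a b, (cubeExp fun v => ∑ t, φ t *
      (α t (Function.update (firstSet d v) j a) * β t (Function.update (secondSet d v) j b)))
      = ∑ t, φ t * (A d j a t * B d j b t) := by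
    intro d j a b
    rw [cubeExp_sum]
    simp only [cubeExp_const_mul, hK]
  set F : (Fin n → Bool) → (Fin n → Bool) → ℝ := fun d v => ∑ t, φ t * G d t v with hF
  have hF0 : ∀ d v, 0 ≤ F d v := fun d v =>
    Finset.sum_nonneg fun t _ => mul_nonneg (hφ0 t) (hG0 d t v)
  have h00 : ∀ d j, ∑ t, φ t * (A d j false t * B d j false t) ≤ 2 * cubeExp (F d) := by
    intro d j
    have e : ∑ t, φ t * (A d j false t * B d j false t)
        = cubeExp fun v => F d (Function.update v j false) := by
      rw [← hφK]
      simp only [hF, hG, firstSet_update_right, secondSet_update_right]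
    rw [e, cubeExp_eq_half j (F d)]
    have : 0 ≤ cubeExp fun v => F d (Function.update v j true) := cubeExp_nonneg fun v => hF0 _ _
    linarith
  have hmain : ∀ d, (cubeExp fun v => ∑ j, ∑ t, φ t *
      (α t (Function.update (firstSet d v) j true) * β t (Function.update (secondSet d v) j true)))
      ≤ n / 2 + 2 * n * cubeExp (F d) + 2 * ∑ j, H j d := by
    intro d
    rw [cubeExp_sum]
    calc _ ≤ ∑ j : Fin n, (1 / 2 + 2 * cubeExp (F d) + 2 * H j d) := by
          refine Finset.sum_le_sum fun j _ => ?_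
          rw [hφK]
          have := sum_mul_sub_le_hellinger _ _ φ
            (fun t => mul_nonneg (hA0 d j false t) (hB0 d j false t))
            (fun t => mul_nonneg (hA0 d j true t) (hB0 d j true t)) (hAB1 d j _ _) (hAB1 d j _ _)
            hφ0 hφ1
          have := h00 d j
          simp only [hH]
          linarith
      _ = _ := by
          rw [Finset.sum_add_distrib, ← Finset.mul_sum]
          simp only [Finset.sum_const, Finset.card_univ, Fintype.card_fin, nsmul_eq_mul]
          ring
  have h5 := cubeExp_mono hmain
  rw [cubeExp_add, cubeExp_add, cubeExp_const, cubeExp_const_mul, cubeExp_const_mul,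
    cubeExp_sum] at h5
  have h6 : ∑ j, cubeExp (H j) ≤ 4 * ∑ j, cubeExp (I j) := by
    rw [Finset.mul_sum]
    exact Finset.sum_le_sum fun j _ => hHI j
  have h7 := cubeExp_mono hIsum
  rw [cubeExp_sum, cubeExp_const_mul] at h7
  simp only [hF, hG] at h5 h7 ⊢
  linarith

end Cube

/-! ### The hard distribution -/

section HardDistribution

variable {n m : ℕ}

/-- The joint weights of the pair `(y, u)` of random disjoint sets. -/
noncomputable def pairWeight (y u : Fin n → Bool) : ℝ :=
  cubeExp fun d => cubeExp fun v => if secondSet d v = y ∧ firstSet d v = u then 1 else 0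

/-- The weights of the set `y`. -/
noncomputable def setWeight (y : Fin n → Bool) : ℝ := ∑ u, pairWeight y u

/-- The weights of the planted element: with probability `γ` it is a uniformly random element. -/
noncomputable def plantWeight (n : ℕ) (γ : ℝ) : Option (Fin n) → ℝ
  | none => 1 - γ
  | some _ => γ / n

/-- The weights, given `y`, of the pair `(u, e)` that makes up the input of one site: a random set
`u` disjoint from `y` and an element `e` planted into it. -/
noncomputable def siteWeight (γ : ℝ) (y : Fin n → Bool) (a : (Fin n → Bool) × Option (Fin n)) : ℝ :=
  pairWeight y a.1 / setWeight y * plantWeight n γ a.2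

/-- The input of a site: the set `u` with the element `e` planted into it. -/
def plant (a : (Fin n → Bool) × Option (Fin n)) : Fin n → Bool :=
  match a.2 with
  | none => a.1
  | some j => Function.update a.1 j true

/-- The indicator that the planted element hits `y`. -/
noncomputable def hit (y : Fin n → Bool) (a : (Fin n → Bool) × Option (Fin n)) : ℝ :=
  match a.2 with
  | none => 0
  | some j => if y j then 1 else 0

lemma hit_eq_zero_or_one (y : Fin n → Bool) (a : (Fin n → Bool) × Option (Fin n)) :
    hit y a = 0 ∨ hit y a = 1 := by
  obtain ⟨u, _ | j⟩ := a <;> simp only [hit]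
  · simp
  · split_ifs <;> simp

lemma pairWeight_nonneg (y u : Fin n → Bool) : 0 ≤ pairWeight y u :=
  cubeExp_nonneg fun _ => cubeExp_nonneg fun _ => by split_ifs <;> norm_num

/-- Averages over the seeds `d` and `v` are averages over pairs of disjoint sets. -/
lemma cubeExp_cubeExp_eq (f : (Fin n → Bool) → (Fin n → Bool) → ℝ) :
    (cubeExp fun d => cubeExp fun v => f (secondSet d v) (firstSet d v))
      = ∑ y, ∑ u, pairWeight y u * f y u := by
  have e : ∀ d v : Fin n → Bool, f (secondSet d v) (firstSet d v)
      = ∑ y, ∑ u, f y u * if secondSet d v = y ∧ firstSet d v = u then 1 else 0 := by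
    intro d v
    simp [ite_and]
  simp only [e, cubeExp_sum, cubeExp_const_mul]
  refine Finset.sum_congr rfl fun y _ => Finset.sum_congr rfl fun u _ => ?_
  rw [pairWeight, mul_comm]

lemma sum_setWeight : ∑ y : Fin n → Bool, setWeight y = 1 := by
  have := cubeExp_cubeExp_eq (n := n) (fun _ _ => 1)
  simp only [cubeExp_const, mul_one] at this
  exact this.symm

lemma setWeight_pos (y : Fin n → Bool) : 0 < setWeight y := by
  have h1 : 0 < pairWeight y (fun _ => false) := by
    have hc : ∀ (f : (Fin n → Bool) → ℝ) (v₀ : Fin n → Bool), (∀ v, 0 ≤ f v) → 0 < f v₀ →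
        0 < cubeExp f := fun f v₀ hf h =>
      Finset.sum_pos' (fun v _ => mul_nonneg (Finset.prod_nonneg fun _ _ => by norm_num) (hf v))
        ⟨v₀, Finset.mem_univ _, mul_pos (Finset.prod_pos fun _ _ => by norm_num) h⟩
    refine hc _ (fun _ => false) (fun d => cubeExp_nonneg fun v => by split_ifs <;> norm_num) ?_
    refine hc _ y (fun v => by split_ifs <;> norm_num) ?_
    rw [if_pos]
    · norm_num
    · constructor <;> ext j <;> simp [secondSet, firstSet]
  exact h1.trans_le (Finset.single_le_sum (fun u _ => pairWeight_nonneg y u) (Finset.mem_univ _))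

lemma pairWeight_disjoint {y u : Fin n → Bool} (h : pairWeight y u ≠ 0) (j : Fin n) (hy : y j) :
    u j = false := by
  by_contra hu
  refine h ?_
  have e : ∀ d v : Fin n → Bool, (if secondSet d v = y ∧ firstSet d v = u then (1 : ℝ) else 0) = 0 := by
    intro d v
    rw [if_neg]
    rintro ⟨rfl, rfl⟩
    simp [firstSet, secondSet] at hy hu
    simp [hy.1] at hu
  simp only [pairWeight, e, cubeExp_const]

lemma plantWeight_nonneg {γ : ℝ} (h0 : 0 ≤ γ) (h1 : γ ≤ 1) (e : Option (Fin n)) :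
    0 ≤ plantWeight n γ e := by
  cases e
  · simp only [plantWeight]; linarith
  · simp only [plantWeight]; positivity

lemma sum_plantWeight (hn : 0 < n) (γ : ℝ) : ∑ e, plantWeight n γ e = 1 := by
  rw [Fintype.sum_option]
  have : (n : ℝ) ≠ 0 := by positivity
  simp only [plantWeight, Finset.sum_const, Finset.card_univ, Fintype.card_fin, nsmul_eq_mul]
  field_simp
  ring

lemma siteWeight_nonneg {γ : ℝ} (h0 : 0 ≤ γ) (h1 : γ ≤ 1) (y : Fin n → Bool)
    (a : (Fin n → Bool) × Option (Fin n)) : 0 ≤ siteWeight γ y a :=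
  mul_nonneg (div_nonneg (pairWeight_nonneg _ _) (setWeight_pos y).le)
    (plantWeight_nonneg h0 h1 _)

lemma sum_siteWeight_mul (γ : ℝ) (y : Fin n → Bool)
    (f : (Fin n → Bool) × Option (Fin n) → ℝ) :
    ∑ a, siteWeight γ y a * f a
      = (∑ u, pairWeight y u * ∑ e, plantWeight n γ e * f (u, e)) / setWeight y := by
  rw [Fintype.sum_prod_type, Finset.sum_div]
  refine Finset.sum_congr rfl fun u _ => ?_
  rw [mul_div_right_comm, Finset.mul_sum]
  exact Finset.sum_congr rfl fun e _ => by rw [siteWeight]; ring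

lemma setWeight_mul_sum_siteWeight (γ : ℝ) (y : Fin n → Bool)
    (f : (Fin n → Bool) × Option (Fin n) → ℝ) :
    setWeight y * ∑ a, siteWeight γ y a * f a
      = ∑ u, pairWeight y u * ∑ e, plantWeight n γ e * f (u, e) := by
  rw [sum_siteWeight_mul, mul_div_cancel₀ _ (setWeight_pos y).ne']

lemma sum_siteWeight (hn : 0 < n) (γ : ℝ) (y : Fin n → Bool) : ∑ a, siteWeight γ y a = 1 := by
  have := sum_siteWeight_mul γ y (fun _ => 1)
  simp only [mul_one, sum_plantWeight hn] at this
  rw [this, ← setWeight, div_self (setWeight_pos y).ne']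

lemma sum_siteWeight_plant (γ : ℝ) (y : Fin n → Bool) (j : Fin n) :
    ∑ a : (Fin n → Bool) × Option (Fin n), (if a.2 = some j then siteWeight γ y a else 0)
      = γ / n := by
  have := sum_siteWeight_mul γ y (fun a => if a.2 = some j then 1 else 0)
  simp only [mul_ite, mul_one, mul_zero, Finset.sum_ite_eq', Finset.mem_univ, if_true] at this
  rw [this, ← Finset.sum_mul, ← setWeight, plantWeight,
    mul_div_cancel_left₀ _ (setWeight_pos y).ne']

/-- Planting a common element into a random pair of disjoint sets. -/
lemma cubeExp_secondSet_apply (j : Fin n) (f : (Fin n → Bool) → (Fin n → Bool) → ℝ) :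
    (cubeExp fun d => cubeExp fun v => (if secondSet d v j then 1 else 0) *
        f (Function.update (firstSet d v) j true) (secondSet d v))
      = 1 / 4 * cubeExp fun d => cubeExp fun v =>
        f (Function.update (firstSet d v) j true) (Function.update (secondSet d v) j true) := by
  rw [cubeExp_eq_half j]
  have e1 : ∀ d : Fin n → Bool, (cubeExp fun v =>
      (if secondSet (Function.update d j true) v j then 1 else 0) *
        f (Function.update (firstSet (Function.update d j true) v) j true)
          (secondSet (Function.update d j true) v)) = 0 := by
    intro d
    have : ∀ v, secondSet (Function.update d j true) v j = false := by simp [secondSet]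
    simp [this, cubeExp_const]
  have e2 : ∀ d : Fin n → Bool, (cubeExp fun v =>
      (if secondSet (Function.update d j false) v j then 1 else 0) *
        f (Function.update (firstSet (Function.update d j false) v) j true)
          (secondSet (Function.update d j false) v))
      = 1 / 2 * cubeExp fun v => f (Function.update (firstSet d v) j true)
          (Function.update (secondSet d v) j true) := by
    intro d
    rw [cubeExp_eq_half j]
    simp only [firstSet_update_false, secondSet_update_false, Function.update_self,
      Function.update_idem, if_true, one_mul, Bool.false_eq_true, if_false, zero_mul,
      cubeExp_const, add_zero]
  simp only [e1, e2, cubeExp_const, cubeExp_const_mul]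
  ring

end HardDistribution

/-- Kraft's inequality, in a weak form: lists over an alphabet with four letters. -/
lemma sum_pow_length_le {A : Type*} [Fintype A] (hA : Fintype.card A = 4) (s : Finset (List A)) :
    ∑ t ∈ s, (1 / 8 : ℝ) ^ t.length ≤ 2 := by
  classical
  set L := s.sup List.length + 1 with hL
  have hmem : ∀ t ∈ s, t.length ∈ Finset.range L := fun t ht => by
    rw [Finset.mem_range, hL]
    exact Nat.lt_succ_of_le (Finset.le_sup (f := List.length) ht)
  rw [← Finset.sum_fiberwise_of_maps_to hmem]
  have hfib : ∀ l ∈ Finset.range L, ∑ t ∈ s with t.length = l, (1 / 8 : ℝ) ^ t.length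
      ≤ (1 / 2 : ℝ) ^ l := by
    intro l _
    have hcard : (s.filter fun t => t.length = l).card ≤ 4 ^ l := by
      rw [← hA, ← card_vector l, ← Finset.card_univ]
      refine Finset.card_le_card_of_surjOn (fun v : List.Vector A l => v.toList) ?_
      intro t ht
      have ht' : t.length = l := by simpa using (Finset.mem_filter.mp ht).2
      exact ⟨⟨t, ht'⟩, Finset.mem_coe.mpr (Finset.mem_univ _), rfl⟩
    calc ∑ t ∈ s with t.length = l, (1 / 8 : ℝ) ^ t.length
        = ∑ t ∈ s with t.length = l, (1 / 8 : ℝ) ^ l :=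
          Finset.sum_congr rfl fun t ht => by rw [(Finset.mem_filter.mp ht).2]
      _ = ((s.filter fun t => t.length = l).card : ℝ) * (1 / 8 : ℝ) ^ l := by
          rw [Finset.sum_const, nsmul_eq_mul]
      _ ≤ (4 : ℝ) ^ l * (1 / 8 : ℝ) ^ l :=
          mul_le_mul_of_nonneg_right (by exact_mod_cast hcard) (by positivity)
      _ = (1 / 2 : ℝ) ^ l := by rw [← mul_pow]; norm_num
  refine (Finset.sum_le_sum hfib).trans ?_
  have := (summable_geometric_of_lt_one (by norm_num : (0 : ℝ) ≤ 1 / 2) (by norm_num)).sum_le_tsum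
    (Finset.range L) (fun i _ => by positivity)
  rwa [tsum_geometric_of_lt_one (by norm_num) (by norm_num), (by norm_num : (1 - 1 / 2 : ℝ)⁻¹ = 2)]
    at this

instance : Fintype ChannelEvent :=
  Fintype.ofEquiv (Bool × Bool)
    { toFun := fun p => if p.1 then .down p.2 else .up p.2
      invFun := fun e => match e with
        | .down b => (true, b)
        | .up b => (false, b)
      left_inv := by rintro ⟨_ | _, _⟩ <;> rfl
      right_inv := by rintro (_ | _) <;> rfl }

lemma card_channelEvent : Fintype.card ChannelEvent = 4 := by
  rw [Fintype.card_congr (Fintype.equivOfCardEq (Fintype.ofEquiv_card _))]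
  simp

open Classical in
/-- The number of elements that are hit by the planted elements, each counted once. -/
noncomputable def numHit {n m : ℕ} {S : Type*} (mk : S → Option (Fin n)) (y : Fin n → Bool)
    (s : Fin m → S) : ℝ :=
  ∑ j, if y j ∧ ∃ i, mk (s i) = some j then 1 else 0

/-- The variance of the number of collisions, which is the difference between the number of hits
with and without multiplicities, is small: resampling one site changes this number only if an element
planted there is also planted at another site. -/
lemma collision_variance {n m : ℕ} {S : Type*} [Fintype S] (κ : S → ℝ) (hκ : ∀ a, 0 ≤ κ a)
    (hκ1 : ∑ a, κ a = 1) (mk : S → Option (Fin n)) (γ : ℝ) (hn : 0 < n)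
    (hmk : ∀ j, ∑ a, (if mk a = some j then κ a else 0) = γ / n) (y : Fin n → Bool) (z : S → ℝ)
    (hz : ∀ a, z a = ∑ j, if y j ∧ mk a = some j then 1 else 0) (K : (Fin m → S) → ℝ)
    (hK : ∀ s, K s = ∑ i, z (s i) - numHit mk y s) :
    prodExp (fun _ => κ) (fun s => (K s - prodExp (fun _ => κ) K) ^ 2) ≤ (m * γ) ^ 2 / n := by
  classical
  have hq1 : ∀ _ : Fin m, ∑ a, κ a = 1 := fun _ => hκ1
  have hvar : prodExp (fun _ => κ) (fun s => (K s - prodExp (fun _ => κ) K) ^ 2)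
      = prodExp (fun _ => κ) (fun s => K s ^ 2) - prodExp (fun _ => κ) K ^ 2 := by
    set μ := prodExp (fun _ => κ) K
    have e : ∀ s, (K s - μ) ^ 2 = K s ^ 2 - ((2 * μ) * K s - μ ^ 2) := fun s => by ring
    simp only [e]
    rw [prodExp_sub, prodExp_sub, prodExp_const_mul, prodExp_const hq1]
    ring
  rw [hvar]
  refine (efron_stein (fun _ => κ) (fun _ => hκ) (fun _ => hκ1) K).trans ?_
  -- the elements occupied by the other sites
  let occ : Fin m → (Fin m → S) → Fin n → Prop := fun i s j => ∃ k, k ≠ i ∧ mk (s k) = some j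
  have hstep : ∀ i s, ∑ a, κ a * K (Function.update s i a) ^ 2
      - (∑ a, κ a * K (Function.update s i a)) ^ 2
      ≤ γ / n * ∑ k, ∑ j, if mk (s k) = some j then 1 else 0 := by
    intro i s
    set c : ℝ := ∑ k ∈ Finset.univ.erase i, z (s k) - ∑ j, if y j ∧ occ i s j then 1 else 0 with hc
    have hd : ∀ a, K (Function.update s i a) - c
        = ∑ j, if y j ∧ mk a = some j ∧ occ i s j then 1 else 0 := by
      intro a
      have e1 : ∑ k, z (Function.update s i a k) = z a + ∑ k ∈ Finset.univ.erase i, z (s k) := by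
        rw [← Finset.add_sum_erase _ _ (Finset.mem_univ i), Function.update_self]
        congr 1
        exact Finset.sum_congr rfl fun k hk => by
          rw [Function.update_of_ne (Finset.ne_of_mem_erase hk)]
      have e2 : ∀ j, (∃ k, mk (Function.update s i a k) = some j) ↔ mk a = some j ∨ occ i s j := by
        intro j
        constructor
        · rintro ⟨k, hk⟩
          by_cases h : k = i
          · subst h; rw [Function.update_self] at hk; exact Or.inl hk
          · rw [Function.update_of_ne h] at hk; exact Or.inr ⟨k, h, hk⟩
        · rintro (h | ⟨k, hk, h⟩)
          · exact ⟨i, by rwa [Function.update_self]⟩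
          · exact ⟨k, by rwa [Function.update_of_ne hk]⟩
      rw [hK, e1, hc, hz, numHit]
      have e3 : ∀ x w u v : ℝ, x + w - u - (w - v) = x - u + v := fun _ _ _ _ => by ring
      rw [e3, ← Finset.sum_sub_distrib, ← Finset.sum_add_distrib]
      refine Finset.sum_congr rfl fun j _ => ?_
      simp only [e2]
      by_cases h1 : y j <;> by_cases h2 : mk a = some j <;> by_cases h3 : occ i s j <;>
        simp [h1, h2, h3]
    have hg : ∀ a, (∑ j, if y j ∧ mk a = some j ∧ occ i s j then (1 : ℝ) else 0) ^ 2
        ≤ ∑ j, if occ i s j then (if mk a = some j then 1 else 0) else 0 := by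
      intro a
      cases h : mk a with
      | none => simp
      | some j₀ =>
        have e4 : ∀ j, (if y j ∧ some j₀ = some j ∧ occ i s j then (1 : ℝ) else 0)
            = if j₀ = j then (if y j ∧ occ i s j then 1 else 0) else 0 := by
          intro j
          by_cases h1 : j₀ = j <;> simp [h1]
        have e5 : ∀ j, (if occ i s j then (if some j₀ = some j then (1 : ℝ) else 0) else 0)
            = if j₀ = j then (if occ i s j then 1 else 0) else 0 := by
          intro j
          by_cases h1 : j₀ = j <;> simp [h1]
        simp only [e4, e5, Finset.sum_ite_eq, Finset.mem_univ, if_true]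
        by_cases h1 : y j₀ <;> by_cases h3 : occ i s j₀ <;> simp [h1, h3]
    have hle : ∑ a, κ a * K (Function.update s i a) ^ 2
        - (∑ a, κ a * K (Function.update s i a)) ^ 2
        ≤ ∑ a, κ a * (K (Function.update s i a) - c) ^ 2 := by
      have e : ∀ a, κ a * (K (Function.update s i a) - c) ^ 2
          = κ a * K (Function.update s i a) ^ 2 - (2 * c) * (κ a * K (Function.update s i a))
            + c ^ 2 * κ a := fun a => by ring
      simp only [e, Finset.sum_add_distrib, Finset.sum_sub_distrib, ← Finset.mul_sum, hκ1]
      nlinarith [sq_nonneg (∑ a, κ a * K (Function.update s i a) - c)]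
    refine hle.trans ?_
    simp only [hd]
    calc _ ≤ ∑ a, κ a * ∑ j, if occ i s j then (if mk a = some j then 1 else 0) else 0 :=
          Finset.sum_le_sum fun a _ => mul_le_mul_of_nonneg_left (hg a) (hκ a)
      _ = ∑ j, if occ i s j then γ / n else 0 := by
          simp only [Finset.mul_sum]
          rw [Finset.sum_comm]
          refine Finset.sum_congr rfl fun j _ => ?_
          split_ifs
          · simp only [mul_ite, mul_one, mul_zero, hmk]
          · simp
      _ = γ / n * ∑ j, if occ i s j then 1 else 0 := by
          rw [Finset.mul_sum]
          exact Finset.sum_congr rfl fun j _ => by split_ifs <;> simp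
      _ ≤ γ / n * ∑ j, ∑ k, if mk (s k) = some j then 1 else 0 := by
          refine mul_le_mul_of_nonneg_left (Finset.sum_le_sum fun j _ => ?_) ?_
          · split_ifs with h
            · obtain ⟨k, -, hk⟩ := h
              have := Finset.single_le_sum (f := fun k => if mk (s k) = some j then (1 : ℝ) else 0)
                (fun k _ => by split_ifs <;> norm_num) (Finset.mem_univ k)
              simpa only [hk, if_true] using this
            · exact Finset.sum_nonneg fun k _ => by split_ifs <;> norm_num
          · have : Nonempty (Fin n) := ⟨⟨0, hn⟩⟩
            rw [← hmk ⟨0, hn⟩]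
            exact Finset.sum_nonneg fun a _ => by split_ifs <;> simp [hκ]
      _ = _ := by rw [Finset.sum_comm]
  have hE : prodExp (fun _ => κ) (fun s : Fin m → S => γ / n * ∑ k, ∑ j, if mk (s k) = some j then 1 else 0)
      = γ / n * (m * γ) := by
    rw [prodExp_const_mul, prodExp_sum]
    have e : ∀ k : Fin m, prodExp (fun _ => κ) (fun s => ∑ j, if mk (s k) = some j then 1 else 0)
        = γ := by
      intro k
      rw [prodExp_sum]
      have e' : ∀ j, prodExp (fun _ => κ) (fun s : Fin m → S => if mk (s k) = some j then 1 else 0)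
          = γ / n := by
        intro j
        rw [prodExp_coord hq1 k (fun a => if mk a = some j then 1 else 0), ← hmk j]
        simp only [mul_ite, mul_one, mul_zero]
      have : (n : ℝ) ≠ 0 := by positivity
      simp only [e', Finset.sum_const, Finset.card_univ, Fintype.card_fin, nsmul_eq_mul]
      field_simp
    simp only [e, Finset.sum_const, Finset.card_univ, Fintype.card_fin, nsmul_eq_mul]
  calc _ ≤ ∑ _i : Fin m, γ / n * (m * γ) := by
        refine Finset.sum_le_sum fun i _ => ?_
        rw [← hE]
        exact prodExp_mono (fun _ => hκ) fun s _ => hstep i s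
    _ = _ := by
        simp only [Finset.sum_const, Finset.card_univ, Fintype.card_fin, nsmul_eq_mul]
        ring

/-! ### The communication of a single site -/

/-- What the argument uses of a deterministic protocol when the set `y` is held by one site and the
sets `X i` by the others: the complete transcript `full y X`, in which `hist i` is the history of the
channel of site `i`, and for which the inputs leading to a given transcript form a box, `cons i t`
being the inputs of site `i` that are consistent with the history `t`. -/
structure BoxTranscript (m n : ℕ) (Θ : Type) where
  full : (Fin n → Bool) → (Fin m → Fin n → Bool) → Θ
  hist : Fin m → Θ → List ChannelEvent
  cons : Fin m → List ChannelEvent → (Fin n → Bool) → Prop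
  cons_hist : ∀ y X i, cons i (hist i (full y X)) (X i)
  box : ∀ y X X', (∀ i, cons i (hist i (full y X)) (X' i)) → full y X' = full y X

namespace BoxTranscript

variable {m n : ℕ} {Θ : Type} (B : BoxTranscript m n Θ)

/-- The transcript as a function of the random data `(u, e)` of the sites. -/
def run (y : Fin n → Bool) (s : Fin m → (Fin n → Bool) × Option (Fin n)) : Θ :=
  B.full y fun i => plant (s i)

/-- The posterior variance of the indicator that site `i` hits `y`, given the transcript and `y`. -/
noncomputable def hitVar (γ : ℝ) (y : Fin n → Bool) (i : Fin m) (θ : Θ) : ℝ :=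
  posteriorVar (siteWeight γ y) (hit y) fun a => B.cons i (B.hist i θ) (plant a)

open Classical in
/-- The more likely answer to the question whether site `i` hits `y`, given `y` and the history of
its channel. -/
noncomputable def guess (γ : ℝ) (y : Fin n → Bool) (i : Fin m) (t : List ChannelEvent) : Bool :=
  decide (1 / 2 < posteriorMean (siteWeight γ y) (hit y) fun a => B.cons i t (plant a))

/-- The expectation of `g` at the history of site `i` and the guess, when site `i` holds `x` and the
inputs of the other sites are random. -/
noncomputable def siteExp (γ : ℝ) (i : Fin m) (g : List ChannelEvent → Bool → ℝ)
    (x y : Fin n → Bool) : ℝ :=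
  prodExp (fun _ : Fin m => siteWeight γ y) fun s =>
    g (B.hist i (B.full y (Function.update (fun k => plant (s k)) i x)))
      (B.guess γ y i (B.hist i (B.full y (Function.update (fun k => plant (s k)) i x))))

lemma hist_update_iff (i : Fin m) (y : Fin n → Bool) (X : Fin m → Fin n → Bool)
    (x : Fin n → Bool) (t : List ChannelEvent) :
    B.hist i (B.full y (Function.update X i x)) = t ↔
      B.cons i t x ∧ ∃ x', B.hist i (B.full y (Function.update X i x')) = t := by
  constructor
  · intro h
    refine ⟨?_, x, h⟩
    have := B.cons_hist y (Function.update X i x) i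
    rwa [h, Function.update_self] at this
  · rintro ⟨hc, x', hx'⟩
    rw [← hx']
    congr 1
    refine B.box _ _ _ fun k => ?_
    by_cases h : k = i
    · subst h
      rw [Function.update_self, hx']
      exact hc
    · have := B.cons_hist y (Function.update X i x') k
      rw [Function.update_of_ne h] at this ⊢
      exact this

lemma prodExp_eq_siteExp {γ : ℝ} (hn : 0 < n) (y : Fin n → Bool) (i : Fin m)
    (g : List ChannelEvent → Bool → (Fin n → Bool) × Option (Fin n) → ℝ) :
    prodExp (fun _ : Fin m => siteWeight γ y) (fun s =>
        g (B.hist i (B.run y s)) (B.guess γ y i (B.hist i (B.run y s))) (s i))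
      = ∑ a, siteWeight γ y a * B.siteExp γ i (fun t o => g t o a) (plant a) y := by
  rw [← prodExp_update (fun _ => sum_siteWeight hn γ y) i]
  refine Finset.sum_congr rfl fun a _ => ?_
  have e : ∀ s : Fin m → (Fin n → Bool) × Option (Fin n),
      B.run y (Function.update s i a) = B.full y (Function.update (fun k => plant (s k)) i (plant a)) := by
    intro s
    rw [run]
    congr 1
    ext k : 1
    by_cases h : k = i
    · subst h; simp
    · simp [h]
  simp only [e, Function.update_self, siteExp]

/-- The bound for a single site: its communication is linear in `n` unless the posterior variance
of its hitting `y` is comparable to the prior variance. -/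
lemma site_bound {γ : ℝ} (hn : 0 < n) (h0 : 0 < γ) (h1 : γ ≤ 1 / 2) (i : Fin m) :
    (n : ℝ) / 2 ≤ 12 * n / γ * (∑ y, setWeight y * prodExp (fun _ : Fin m => siteWeight γ y)
        (fun s => B.hitVar γ y i (B.run y s)))
      + 192 * (∑ y, setWeight y * prodExp (fun _ : Fin m => siteWeight γ y)
        (fun s => ((B.hist i (B.run y s)).length : ℝ))) + 64 := by
  classical
  have hκ : ∀ y a, 0 ≤ siteWeight (n := n) γ y a := siteWeight_nonneg h0.le (by linarith)
  have hκ1 : ∀ y : Fin n → Bool, ∀ _ : Fin m, ∑ a, siteWeight γ y a = 1 :=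
    fun y _ => sum_siteWeight hn γ y
  set e := ∑ y, setWeight y * prodExp (fun _ : Fin m => siteWeight γ y)
        (fun s => B.hitVar γ y i (B.run y s)) with he
  set ℓ := ∑ y, setWeight y * prodExp (fun _ : Fin m => siteWeight γ y)
        (fun s => ((B.hist i (B.run y s)).length : ℝ)) with hℓ
  -- the finite set of the histories of site `i`
  set 𝒯 : Finset (List ChannelEvent) := Finset.univ.image
    fun p : (Fin n → Bool) × (Fin m → Fin n → Bool) => B.hist i (B.full p.1 p.2) with h𝒯
  have hmem : ∀ y X, B.hist i (B.full y X) ∈ 𝒯 := fun y X =>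
    Finset.mem_image.mpr ⟨(y, X), Finset.mem_univ _, rfl⟩
  -- the guess of the party that holds `y` is appended to the history as a last bit
  set α : 𝒯 × Bool → (Fin n → Bool) → ℝ := fun t x => if B.cons i t.1 x then 1 else 0 with hα
  set β : 𝒯 × Bool → (Fin n → Bool) → ℝ := fun t y =>
    prodExp (fun _ : Fin m => siteWeight γ y) fun s =>
      if (∃ x', B.hist i (B.full y (Function.update (fun k => plant (s k)) i x')) = t.1) ∧
        B.guess γ y i t.1 = t.2 then 1 else 0 with hβ
  have hαβ : ∀ (g : List ChannelEvent → Bool → ℝ) x y,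
      ∑ t : 𝒯 × Bool, g t.1 t.2 * (α t x * β t y) = B.siteExp γ i g x y := by
    intro g x y
    simp only [hα, hβ, siteExp]
    have e1 : ∀ t : 𝒯 × Bool, g t.1 t.2 * ((if B.cons i t.1 x then 1 else 0) *
        prodExp (fun _ : Fin m => siteWeight γ y) fun s =>
        if (∃ x', B.hist i (B.full y (Function.update (fun k => plant (s k)) i x')) = t.1) ∧
          B.guess γ y i t.1 = t.2 then 1 else 0)
        = prodExp (fun _ : Fin m => siteWeight γ y) fun s => g t.1 t.2 *
          if B.hist i (B.full y (Function.update (fun k => plant (s k)) i x)) = t.1 ∧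
            B.guess γ y i t.1 = t.2 then 1 else 0 := by
      intro t
      rw [← prodExp_const_mul, ← prodExp_const_mul]
      refine prodExp_congr fun s _ => ?_
      simp only [B.hist_update_iff i y _ x]
      by_cases a1 : B.cons i t.1 x <;> simp [a1]
    simp only [e1]
    rw [← prodExp_sum]
    refine prodExp_congr fun s _ => ?_
    set τ := B.hist i (B.full y (Function.update (fun k => plant (s k)) i x)) with hτ
    rw [Finset.sum_eq_single ((⟨τ, hmem _ _⟩, B.guess γ y i τ) : 𝒯 × Bool)]
    · simp
    · rintro ⟨⟨t, ht⟩, o⟩ - hne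
      rw [if_neg, mul_zero]
      rintro ⟨rfl, h⟩
      exact hne (Prod.ext rfl h.symm)
    · simp
  -- the codeword lengths `3 * length + 2` leave room for the appended bit
  have hkraft : ∑ t : 𝒯 × Bool, Real.exp (-(3 * (t.1 : List ChannelEvent).length + 2 : ℝ)) ≤ 1 := by
    rw [Fintype.sum_prod_type]
    simp only [Finset.sum_const, Finset.card_univ, Fintype.card_bool, nsmul_eq_mul]
    have he2 : Real.exp (-2) ≤ 1 / 4 := by
      rw [Real.exp_neg, inv_eq_one_div]
      refine one_div_le_one_div_of_le (by norm_num) ?_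
      have := Real.exp_one_gt_d9
      have h : Real.exp 2 = Real.exp 1 ^ 2 := by rw [← Real.exp_nat_mul]; norm_num
      rw [h]; nlinarith
    have he3 : Real.exp (-3) ≤ 1 / 8 := by
      rw [Real.exp_neg, inv_eq_one_div]
      refine one_div_le_one_div_of_le (by norm_num) ?_
      have := Real.exp_one_gt_d9
      have h : Real.exp 3 = Real.exp 1 ^ 3 := by rw [← Real.exp_nat_mul]; norm_num
      rw [h]
      calc (8 : ℝ) = 2 ^ 3 := by norm_num
        _ ≤ _ := pow_le_pow_left₀ (by norm_num) (by linarith) 3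
    have e1 : ∀ t : 𝒯, ((2 : ℕ) : ℝ) * Real.exp (-(3 * (t : List ChannelEvent).length + 2 : ℝ))
        ≤ 1 / 2 * (1 / 8 : ℝ) ^ (t : List ChannelEvent).length := by
      intro t
      have : Real.exp (-(3 * (t : List ChannelEvent).length + 2 : ℝ))
          = Real.exp (-2) * Real.exp (-3) ^ (t : List ChannelEvent).length := by
        rw [← Real.exp_nat_mul, ← Real.exp_add]; ring_nf
      rw [this]
      have h3 := pow_le_pow_left₀ (Real.exp_pos (-3)).le he3 (t : List ChannelEvent).length
      have h4 : 0 ≤ Real.exp (-3) ^ (t : List ChannelEvent).length := by positivity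
      have h5 := mul_le_mul he2 h3 h4 (by norm_num)
      push_cast
      linarith
    refine (Finset.sum_le_sum fun t _ => e1 t).trans ?_
    rw [← Finset.mul_sum]
    have := sum_pow_length_le card_channelEvent 𝒯
    rw [← Finset.sum_coe_sort] at this
    linarith
  have hdisj := disjointness_bound α β (fun t x => by simp only [hα]; split_ifs <;> norm_num)
    (fun t y => prodExp_nonneg (fun _ => hκ y) fun s _ => by split_ifs <;> norm_num)
    (fun x y => by
      have := hαβ (fun _ _ => 1) x y
      simp only [one_mul] at this
      rw [this, siteExp, prodExp_const (hκ1 y)])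
    (fun t => if t.2 then 1 else 0) (fun t => 3 * (t.1 : List ChannelEvent).length + 2)
    (fun t => by split_ifs <;> norm_num) (fun t => by split_ifs <;> norm_num) hkraft
  set Φ : (Fin n → Bool) → (Fin n → Bool) → ℝ :=
    B.siteExp γ i (fun _ o => if o then 1 else 0) with hΦ
  set Lh : (Fin n → Bool) → (Fin n → Bool) → ℝ :=
    B.siteExp γ i (fun t _ => (t.length : ℝ)) with hLh
  have hΦeq : ∀ x y, ∑ t : 𝒯 × Bool, (if t.2 then (1 : ℝ) else 0) * (α t x * β t y) = Φ x y :=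
    fun x y => hαβ (fun _ o => if o then 1 else 0) x y
  have hLeq : ∀ x y, ∑ t : 𝒯 × Bool, (3 * (t.1 : List ChannelEvent).length + 2 : ℝ) *
      (α t x * β t y) = 3 * Lh x y + 2 := by
    intro x y
    rw [hαβ (fun t _ => (3 * t.length + 2 : ℝ)) x y, hLh, siteExp, siteExp, prodExp_add,
      prodExp_const_mul, prodExp_const (hκ1 y)]
  simp only [hΦeq, hLeq, cubeExp_add, cubeExp_const_mul, cubeExp_const, cubeExp_sum] at hdisj
  have hsite0 : ∀ (g : List ChannelEvent → Bool → ℝ), (∀ t o, 0 ≤ g t o) → ∀ x y,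
      0 ≤ B.siteExp γ i g x y := fun g hg x y =>
    prodExp_nonneg (fun _ => hκ y) fun s _ => hg _ _
  have hΦ1 : ∀ x y, Φ x y ≤ 1 := by
    intro x y
    refine (prodExp_mono (fun _ => hκ y) (g := fun _ => 1) fun s _ => ?_).trans
      (prodExp_const (hκ1 y) 1).le
    dsimp only
    split_ifs <;> norm_num
  -- a site without planted element contributes a bounded fraction of any average
  have hnone : ∀ (g : (Fin n → Bool) → List ChannelEvent → Bool →
      (Fin n → Bool) × Option (Fin n) → ℝ), (∀ y t o a, 0 ≤ g y t o a) →
      ∀ g' : List ChannelEvent → Bool → ℝ, (∀ y t o u, g y t o (u, none) = g' t o) →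
      (1 - γ) * (cubeExp fun d => cubeExp fun v =>
          B.siteExp γ i g' (firstSet d v) (secondSet d v))
        ≤ ∑ y, setWeight y * prodExp (fun _ : Fin m => siteWeight γ y) (fun s =>
          g y (B.hist i (B.run y s)) (B.guess γ y i (B.hist i (B.run y s))) (s i)) := by
    intro g hg g' hg'
    rw [cubeExp_cubeExp_eq (fun y u => B.siteExp γ i g' u y), Finset.mul_sum]
    refine Finset.sum_le_sum fun y _ => ?_
    rw [B.prodExp_eq_siteExp hn, setWeight_mul_sum_siteWeight, Finset.mul_sum]
    refine Finset.sum_le_sum fun u _ => ?_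
    rw [← mul_assoc, mul_comm (1 - γ), mul_assoc]
    refine mul_le_mul_of_nonneg_left ?_ (pairWeight_nonneg y u)
    rw [Fintype.sum_option]
    have : 0 ≤ ∑ j : Fin n, plantWeight n γ (some j) *
        B.siteExp γ i (fun t o => g y t o (u, some j)) (plant (u, some j)) y :=
      Finset.sum_nonneg fun j _ => mul_nonneg (plantWeight_nonneg h0.le (by linarith) _)
        (hsite0 _ (fun t o => hg y t o _) _ _)
    simp only [plantWeight, hg', plant] at this ⊢
    linarith
  have hL : (1 - γ) * (cubeExp fun d => cubeExp fun v => Lh (firstSet d v) (secondSet d v)) ≤ ℓ :=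
    hnone (fun _ t _ _ => (t.length : ℝ)) (fun _ t _ _ => Nat.cast_nonneg _) _
      (fun _ _ _ _ => rfl)
  have hcons : ∀ y (s : Fin m → (Fin n → Bool) × Option (Fin n)) k,
      B.cons k (B.hist k (B.run y s)) (plant (s k)) := fun y s k => B.cons_hist _ _ _
  have hbox : ∀ y (s s' : Fin m → (Fin n → Bool) × Option (Fin n)),
      (∀ k, B.cons k (B.hist k (B.run y s)) (plant (s' k))) → B.run y s' = B.run y s :=
    fun y s s' h => B.box _ _ _ h
  have hz0 : ∀ y (a : (Fin n → Bool) × Option (Fin n)), 0 ≤ hit y a ∧ hit y a ≤ 1 := fun y a => by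
    rcases hit_eq_zero_or_one y a with h | h <;> rw [h] <;> norm_num
  have htwo : 2 * e = ∑ y, setWeight y * (2 * prodExp (fun _ : Fin m => siteWeight γ y)
        (fun s => B.hitVar γ y i (B.run y s))) := by
    rw [he, Finset.mul_sum]
    exact Finset.sum_congr rfl fun y _ => by ring
  have hfp : (1 - γ) * (cubeExp fun d => cubeExp fun v => Φ (firstSet d v) (secondSet d v))
      ≤ 2 * e := by
    refine (hnone (fun y _ o a => (if o then 1 else 0) * (1 - hit y a)) (fun y t o a => ?_) _
      (fun y t o u => ?_)).trans ?_
    · refine mul_nonneg (by split_ifs <;> norm_num) (by linarith [(hz0 y a).2])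
    · simp [hit]
    · rw [htwo]
      refine Finset.sum_le_sum fun y _ => mul_le_mul_of_nonneg_left ?_ (setWeight_pos y).le
      have := false_positive_le (ι := Fin m) (hκ y) (hit_eq_zero_or_one y) (B.run y)
        (fun k θ a => B.cons k (B.hist k θ) (plant a)) (hcons y) (hbox y) i
      simpa only [guess, hitVar, decide_eq_true_eq] using this
  have hfn : γ / (4 * n) * (n - ∑ j, cubeExp fun d => cubeExp fun v =>
      Φ (Function.update (firstSet d v) j true) (Function.update (secondSet d v) j true))
      ≤ 2 * e := by
    have hle : ∑ y, setWeight y * prodExp (fun _ : Fin m => siteWeight γ y) (fun s =>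
        (1 - if B.guess γ y i (B.hist i (B.run y s)) then 1 else 0) * hit y (s i)) ≤ 2 * e := by
      rw [htwo]
      refine Finset.sum_le_sum fun y _ => mul_le_mul_of_nonneg_left ?_ (setWeight_pos y).le
      have := false_negative_le (ι := Fin m) (hκ y) (hit_eq_zero_or_one y) (B.run y)
        (fun k θ a => B.cons k (B.hist k θ) (plant a)) (hcons y) (hbox y) i
      simpa only [guess, hitVar, decide_eq_true_eq] using this
    refine le_trans (le_of_eq ?_) hle
    have hy : ∀ y : Fin n → Bool, setWeight y * prodExp (fun _ : Fin m => siteWeight γ y) (fun s =>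
        (1 - if B.guess γ y i (B.hist i (B.run y s)) then 1 else 0) * hit y (s i))
        = ∑ j, γ / n * ∑ u, pairWeight y u * ((if y j then 1 else 0) *
            (1 - Φ (Function.update u j true) y)) := by
      intro y
      rw [B.prodExp_eq_siteExp hn y i (fun _ o a => (1 - if o then 1 else 0) * hit y a),
        setWeight_mul_sum_siteWeight]
      have hu : ∀ u, ∑ p, plantWeight n γ p * B.siteExp γ i
          (fun _ o => (1 - if o then 1 else 0) * hit y (u, p)) (plant (u, p)) y
          = ∑ j, γ / n * ((if y j then 1 else 0) * (1 - Φ (Function.update u j true) y)) := by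
        intro u
        rw [Fintype.sum_option]
        have e0 : B.siteExp γ i (fun _ o => (1 - if o then 1 else 0) * hit y (u, none))
            (plant (u, none)) y = 0 := by
          simp only [siteExp, hit, mul_zero]
          exact prodExp_const (hκ1 y) 0
        rw [e0, mul_zero, zero_add]
        refine Finset.sum_congr rfl fun j _ => ?_
        rw [plantWeight]
        congr 1
        simp only [siteExp, hit, plant, hΦ]
        rw [← prodExp_const (hκ1 y) 1, ← prodExp_sub, ← prodExp_const_mul]
        simp only [prodExp_const (hκ1 y), mul_comm]
      simp only [hu, Finset.mul_sum]
      rw [Finset.sum_comm]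
      exact Finset.sum_congr rfl fun j _ => Finset.sum_congr rfl fun u _ => by ring
    simp only [hy]
    rw [Finset.sum_comm]
    have hj : ∀ j : Fin n, ∑ y, γ / n * ∑ u, pairWeight y u * ((if y j then 1 else 0) *
            (1 - Φ (Function.update u j true) y))
        = γ / n * (1 / 4 * (1 - cubeExp fun d => cubeExp fun v =>
          Φ (Function.update (firstSet d v) j true) (Function.update (secondSet d v) j true))) := by
      intro j
      rw [← Finset.mul_sum, ← cubeExp_cubeExp_eq (fun y u => (if y j then 1 else 0) *
            (1 - Φ (Function.update u j true) y)),
        cubeExp_secondSet_apply j (fun x y => 1 - Φ x y)]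
      simp only [cubeExp_sub, cubeExp_const]
    simp only [hj, ← Finset.mul_sum, Finset.sum_sub_distrib, Finset.sum_const, Finset.card_univ,
      Fintype.card_fin, nsmul_eq_mul, mul_one]
    ring
  set Φ11 := ∑ j, cubeExp fun d => cubeExp fun v =>
      Φ (Function.update (firstSet d v) j true) (Function.update (secondSet d v) j true)
  set Φ00 := cubeExp fun d => cubeExp fun v => Φ (firstSet d v) (secondSet d v) with hΦ00
  set L00 := cubeExp fun d => cubeExp fun v => Lh (firstSet d v) (secondSet d v) with hL00
  have hn' : (0 : ℝ) < n := by exact_mod_cast hn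
  have p0 : 0 ≤ Φ00 := cubeExp_nonneg fun d => cubeExp_nonneg fun v =>
    hsite0 _ (fun t o => by split_ifs <;> norm_num) _ _
  have p1 : 0 ≤ L00 := cubeExp_nonneg fun d => cubeExp_nonneg fun v =>
    hsite0 _ (fun t o => Nat.cast_nonneg _) _ _
  have q1 : Φ00 ≤ 4 * e := by nlinarith
  have q2 : L00 ≤ 2 * ℓ := by nlinarith
  have q3 : n - Φ11 ≤ 8 * n / γ * e := by
    have := mul_le_mul_of_nonneg_left hfn (by positivity : 0 ≤ 4 * n / γ)
    have e1 : 4 * n / γ * (γ / (4 * n) * (n - Φ11)) = n - Φ11 := by field_simp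
    rw [e1] at this
    calc _ ≤ _ := this
      _ = _ := by ring
  have q4 : 8 * n * e ≤ 4 * n / γ * e := by
    have he0 : 0 ≤ e := by linarith
    refine mul_le_mul_of_nonneg_right ?_ he0
    rw [le_div_iff₀ h0]
    nlinarith
  have q5 : 2 * n * Φ00 ≤ 8 * n * e := by nlinarith
  have q6 : 12 * n / γ * e = 8 * n / γ * e + 4 * n / γ * e := by ring
  rw [q6]
  linarith

end BoxTranscript

/-! ### The communication bound -/

lemma plant_apply {n : ℕ} (a : (Fin n → Bool) × Option (Fin n)) (j : Fin n) :
    plant a j = true ↔ a.1 j = true ∨ a.2 = some j := by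
  obtain ⟨u, _ | i⟩ := a
  · simp [plant]
  · by_cases h : j = i
    · subst h; simp [plant]
    · simp [plant, h, Ne.symm h]

lemma hit_eq_sum {n : ℕ} (y : Fin n → Bool) (a : (Fin n → Bool) × Option (Fin n)) :
    hit y a = ∑ j, if y j ∧ a.2 = some j then 1 else 0 := by
  obtain ⟨u, _ | i⟩ := a
  · simp [hit]
  · simp only [hit, Option.some.injEq]
    rw [Finset.sum_eq_single i]
    · simp
    · intro j _ hj
      simp [Ne.symm hj]
    · simp

open Classical in
/-- The number of distinct elements when one site holds the complement of `y` and the other sites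
hold the sets `X i`. -/
noncomputable def numDistinct {n m : ℕ} (y : Fin n → Bool) (X : Fin m → Fin n → Bool) : ℝ :=
  ∑ j, if y j = false ∨ ∃ i, X i j = true then 1 else 0

/-- On the support of the hard distribution the sets `u` of the sites lie outside of `y`, so that
only the hits by planted elements count inside of `y`. -/
lemma numDistinct_eq {n m : ℕ} {γ : ℝ} (y : Fin n → Bool)
    (s : Fin m → (Fin n → Bool) × Option (Fin n)) (hs : ∀ i, siteWeight γ y (s i) ≠ 0) :
    numDistinct y (fun i => plant (s i))
      = ∑ j, (if y j = false then 1 else 0) + numHit Prod.snd y s := by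
  classical
  rw [numDistinct, numHit, ← Finset.sum_add_distrib]
  refine Finset.sum_congr rfl fun j _ => ?_
  cases hy : y j with
  | false => simp
  | true =>
    have h : ∀ i, plant (s i) j = true ↔ (s i).2 = some j := by
      intro i
      rw [plant_apply]
      have hp : pairWeight y (s i).1 ≠ 0 := fun h => hs i (by simp [siteWeight, h])
      simp [pairWeight_disjoint hp j hy]
    simp [h]

namespace BoxTranscript

variable {m n : ℕ} {Θ : Type} (B : BoxTranscript m n Θ)

/-- The communication bound for the hard distribution. -/
lemma cost_bound (out : Θ → ℝ) {C ε δ γ η : ℝ} (hn : 0 < n) (hε : 0 < ε)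
    (h0 : 0 < γ) (h1 : γ ≤ 1 / 2) (hη : 0 < η)
    (hC : ∀ y X, ∑ i, ((B.hist i (B.full y X)).length : ℝ) ≤ C)
    (herr : ∑ y, setWeight y * prodExp (fun _ : Fin m => siteWeight γ y) (fun s =>
      if |out (B.run y s) - numDistinct y (fun i => plant (s i))| ≤ ε * n then 0 else 1) ≤ δ)
    (hr : 1 ≤ 16 * (ε * n) ^ 2) (hΛ : 1 ≤ m * γ) :
    (m : ℝ) * n / 2 ≤ 12 * n / γ * (16 * (ε * n) ^ 2 +
        64 * (m * γ) / η * (δ + (m * γ) ^ 2 / n / (ε * n) ^ 2) + 2 * η * (m * γ))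
      + 192 * C + 64 * m := by
  classical
  have hn' : (0 : ℝ) < n := by exact_mod_cast hn
  have hεn : 0 < ε * n := mul_pos hε hn'
  have hκ : ∀ y a, 0 ≤ siteWeight (n := n) γ y a := siteWeight_nonneg h0.le (by linarith)
  have hκ1 : ∀ y : Fin n → Bool, ∑ a, siteWeight γ y a = 1 := sum_siteWeight hn γ
  set κ : (Fin n → Bool) → Fin m → (Fin n → Bool) × Option (Fin n) → ℝ :=
    fun y _ => siteWeight γ y with hκdef
  have hκ' : ∀ y i a, 0 ≤ κ y i a := fun y _ => hκ y
  have hκ1' : ∀ y i, ∑ a, κ y i a = 1 := fun y _ => hκ1 y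
  set bad : (Fin n → Bool) → (Fin m → (Fin n → Bool) × Option (Fin n)) → ℝ := fun y s =>
    if |out (B.run y s) - numDistinct y (fun i => plant (s i))| ≤ ε * n then 0 else 1 with hbad
  -- the posterior variances are small on average, for each `y`
  have hvar : ∀ y, prodExp (κ y) (fun s => ∑ i, B.hitVar γ y i (B.run y s))
      ≤ 4 * (2 * (ε * n)) ^ 2 + 64 * (m * γ) / η *
        (prodExp (κ y) (bad y) + (m * γ) ^ 2 / n / (ε * n) ^ 2) + 2 * η * (m * γ) := by
    intro y
    set K : (Fin m → (Fin n → Bool) × Option (Fin n)) → ℝ :=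
      fun s => ∑ i, hit y (s i) - numHit Prod.snd y s with hK
    have hKvar := collision_variance (m := m) (siteWeight γ y) (hκ y) (hκ1 y) Prod.snd γ hn
      (sum_siteWeight_plant γ y) y (hit y) (hit_eq_sum y) K (fun s => rfl)
    set μ := prodExp (κ y) K with hμ
    set c₀ : ℝ := ∑ j, if y j = false then 1 else 0 with hc₀
    have hmean : (Fintype.card (Fin m) : ℝ) * ∑ a, siteWeight γ y a * hit y a ≤ m * γ := by
      rw [Fintype.card_fin]
      refine mul_le_mul_of_nonneg_left ?_ (Nat.cast_nonneg m)
      simp only [hit_eq_sum, Finset.mul_sum]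
      rw [Finset.sum_comm]
      calc _ ≤ ∑ _j : Fin n, γ / n := by
            refine Finset.sum_le_sum fun j _ => ?_
            rw [← sum_siteWeight_plant γ y j]
            refine Finset.sum_le_sum fun a _ => ?_
            by_cases h1 : y j <;> by_cases h2 : a.2 = some j <;> simp [h1, h2, hκ y a]
        _ = γ := by
            simp only [Finset.sum_const, Finset.card_univ, Fintype.card_fin, nsmul_eq_mul]
            field_simp
    have hmain := sum_posteriorVar_le (ι := Fin m) (hκ y) (hκ1 y) (hit_eq_zero_or_one y) (B.run y)
      (fun k θ a => B.cons k (B.hist k θ) (plant a)) (fun s k => B.cons_hist _ _ _)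
      (fun s s' h => B.box _ _ _ h) (fun θ => out θ - c₀ + μ) (2 * (ε * n)) (m * γ) η
      (by nlinarith) hΛ hη hmean
    refine hmain.trans ?_
    have hP : prodExp (κ y) (fun s => if 2 * (ε * n) < |∑ i, hit y (s i) -
        (out (B.run y s) - c₀ + μ)| then 1 else 0)
        ≤ prodExp (κ y) (bad y) + (m * γ) ^ 2 / n / (ε * n) ^ 2 := by
      have hpt : ∀ s, (∀ i, κ y i (s i) ≠ 0) →
          (if 2 * (ε * n) < |∑ i, hit y (s i) - (out (B.run y s) - c₀ + μ)| then (1 : ℝ) else 0)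
            ≤ bad y s + 1 / (ε * n) ^ 2 * (K s - μ) ^ 2 := by
        intro s hs
        have hD := numDistinct_eq y s hs
        have hnn : 0 ≤ 1 / (ε * n) ^ 2 * (K s - μ) ^ 2 := by positivity
        simp only [hbad]
        by_cases hb : |out (B.run y s) - numDistinct y (fun i => plant (s i))| ≤ ε * n
        · rw [if_pos hb, zero_add]
          split_ifs with h
          · have e : ∑ i, hit y (s i) - (out (B.run y s) - c₀ + μ) = (K s - μ) -
                (out (B.run y s) - numDistinct y (fun i => plant (s i))) := by
              rw [hD, hK, hc₀]; ring
            rw [e] at h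
            have h2 := abs_sub (K s - μ)
              (out (B.run y s) - numDistinct y (fun i => plant (s i)))
            have h3 : ε * n ≤ |K s - μ| := by linarith
            have h4 : (ε * n) ^ 2 ≤ (K s - μ) ^ 2 := by
              rw [← sq_abs (K s - μ)]
              exact pow_le_pow_left₀ hεn.le h3 2
            rw [one_div, ← div_eq_inv_mul, le_div_iff₀ (by positivity)]
            linarith
          · exact hnn
        · rw [if_neg hb]
          split_ifs <;> linarith
      have h := prodExp_mono (hκ' y) hpt
      rw [prodExp_add, prodExp_const_mul] at h
      refine h.trans ?_
      have h5 := mul_le_mul_of_nonneg_left hKvar (by positivity : 0 ≤ 1 / (ε * n) ^ 2)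
      have e : 1 / (ε * n) ^ 2 * ((m * γ) ^ 2 / n) = (m * γ) ^ 2 / n / (ε * n) ^ 2 := by ring
      rw [e] at h5
      change _ + 1 / (ε * n) ^ 2 * prodExp (fun _ => siteWeight γ y) _ ≤ _
      linarith
    have hc : 0 ≤ 64 * (m * γ) / η := by positivity
    have := mul_le_mul_of_nonneg_left hP hc
    linarith
  have havg : ∀ (f g : (Fin n → Bool) → ℝ), (∀ y, f y ≤ g y) →
      ∑ y, setWeight y * f y ≤ ∑ y, setWeight y * g y := fun f g h =>
    Finset.sum_le_sum fun y _ => mul_le_mul_of_nonneg_left (h y) (setWeight_pos y).le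
  have hE : ∑ i, ∑ y, setWeight y * prodExp (κ y) (fun s => B.hitVar γ y i (B.run y s))
      ≤ 16 * (ε * n) ^ 2 + 64 * (m * γ) / η * (δ + (m * γ) ^ 2 / n / (ε * n) ^ 2)
        + 2 * η * (m * γ) := by
    rw [Finset.sum_comm]
    have e : ∀ y, ∑ i, setWeight y * prodExp (κ y) (fun s => B.hitVar γ y i (B.run y s))
        = setWeight y * prodExp (κ y) (fun s => ∑ i, B.hitVar γ y i (B.run y s)) := by
      intro y
      rw [prodExp_sum, Finset.mul_sum]
    simp only [e]
    refine (havg _ _ hvar).trans ?_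
    have e2 : ∀ y : Fin n → Bool, setWeight y * (4 * (2 * (ε * n)) ^ 2 + 64 * (m * γ) / η *
        (prodExp (κ y) (bad y) + (m * γ) ^ 2 / n / (ε * n) ^ 2) + 2 * η * (m * γ))
        = setWeight y * (16 * (ε * n) ^ 2 + 64 * (m * γ) / η * ((m * γ) ^ 2 / n / (ε * n) ^ 2)
          + 2 * η * (m * γ)) + 64 * (m * γ) / η * (setWeight y * prodExp (κ y) (bad y)) :=
      fun y => by ring
    simp only [e2, Finset.sum_add_distrib, ← Finset.mul_sum, ← Finset.sum_mul, sum_setWeight]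
    have hc : 0 ≤ 64 * (m * γ) / η := by positivity
    have := mul_le_mul_of_nonneg_left herr hc
    linarith
  have hLen : ∑ i, ∑ y, setWeight y * prodExp (κ y)
      (fun s => ((B.hist i (B.run y s)).length : ℝ)) ≤ C := by
    rw [Finset.sum_comm]
    have e : ∀ y, ∑ i, setWeight y * prodExp (κ y)
          (fun s => ((B.hist i (B.run y s)).length : ℝ))
        = setWeight y * prodExp (κ y) (fun s => ∑ i, ((B.hist i (B.run y s)).length : ℝ)) := by
      intro y
      rw [prodExp_sum, Finset.mul_sum]
    simp only [e]
    refine (havg _ (fun _ => C) fun y => ?_).trans ?_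
    · refine (prodExp_mono (hκ' y) fun s _ => hC _ _).trans (prodExp_const (hκ1' y) C).le
    · rw [← Finset.sum_mul, sum_setWeight, one_mul]
  have hsum := Finset.sum_le_sum fun (i : Fin m) (_ : i ∈ Finset.univ) => B.site_bound hn h0 h1 i
  simp only [Finset.sum_add_distrib, ← Finset.mul_sum, Finset.sum_const, Finset.card_univ,
    Fintype.card_fin, nsmul_eq_mul] at hsum
  have := mul_le_mul_of_nonneg_left hE (by positivity : 0 ≤ 12 * n / γ)
  linarith

end BoxTranscript

/-- A set of the first `n` elements of the universe, as a frequency vector. -/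
def indicatorVector {n : ℕ} (N : ℕ) (x : Fin n → Bool) : Fin N → ℕ :=
  fun J => if h : (J : ℕ) < n then (if x ⟨J, h⟩ then 1 else 0) else 0

/-- The hard input: the first site holds the complement of `y`, the others hold the sets `X i`. -/
def hardInput {n m : ℕ} (N : ℕ) (y : Fin n → Bool) (X : Fin m → Fin n → Bool) :
    Fin (m + 1) → Fin N → ℕ :=
  Fin.cons (indicatorVector N fun j => !y j) fun i => indicatorVector N (X i)

lemma distinctElements_hardInput {n m N : ℕ} (hN : n ≤ N) (y : Fin n → Bool)
    (X : Fin m → Fin n → Bool) :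
    (distinctElements (hardInput N y X) : ℝ) = numDistinct y X := by
  classical
  rw [numDistinct, Finset.sum_boole]
  congr 1
  rw [distinctElements, ← Finset.card_map (Fin.castLEEmb hN)]
  congr 1
  ext J
  simp only [Finset.mem_filter, Finset.mem_univ, true_and, Finset.mem_map, hardInput,
    Finset.sum_apply, Fin.sum_univ_succ, Fin.cons_zero, Fin.cons_succ, indicatorVector]
  by_cases h : (J : ℕ) < n
  · have e : ∀ a : Fin n, Fin.castLEEmb hN a = J ↔ a = ⟨J, h⟩ := by
      intro a
      simp [Fin.ext_iff]
    simp only [h, dif_pos, e]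
    simp
    by_cases hy : y ⟨J, h⟩ = true <;> simp [hy]
  · have e : ∀ a : Fin n, Fin.castLE hN a ≠ J := by
      intro a ha
      exact h (by rw [← ha]; simp)
    simp [h, e]

/-- A deterministic protocol on the hard inputs. The output is made part of the transcript. -/
noncomputable def hardTranscript {m : ℕ} (n N : ℕ) (D : DetProtocol (m + 1) (Fin N → ℕ) ℝ) :
    BoxTranscript m n ((Fin (m + 1) → List ChannelEvent) × ℝ) where
  full y X := (D.coordinator.finalHist (fun i => D.site i (hardInput N y X i)) fun _ => [],
    D.out (hardInput N y X))
  hist i θ := θ.1 i.succ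
  cons i t x := Coordinator.Consistent (D.site i.succ (indicatorVector N x)) [] t
  cons_hist y X i := Coordinator.consistent_finalHist
    (fun i => D.site i (hardInput N y X i)) D.coordinator (fun _ => []) i.succ
  box y X X' h := by
    have := Coordinator.finalHist_eq_of_consistent (fun i => D.site i (hardInput N y X i))
      (fun i => D.site i (hardInput N y X' i)) D.coordinator (fun _ => []) (fun i => by
        refine Fin.cases ?_ (fun i => ?_) i
        · exact Coordinator.consistent_finalHist
            (fun i => D.site i (hardInput N y X i)) D.coordinator (fun _ => []) 0
        · exact h i)
    exact Prod.ext this.1 this.2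

/-- The communication bound for randomized protocols, with the parameters of the hard distribution
still free. -/
lemma randProtocol_cost_bound {m n N C : ℕ} {ε δ γ η : ℝ}
    (P : RandProtocol (m + 1) (Fin N → ℕ) ℝ) (hP : ComputesF0 P ε δ)
    (hC : ∀ ω x, (P.det ω).cost x ≤ C) (hN : n ≤ N) (hn : 0 < n) (hε : 0 < ε)
    (h0 : 0 < γ) (h1 : γ ≤ 1 / 2) (hη : 0 < η) (hr : 1 ≤ 16 * (ε * n) ^ 2) (hΛ : 1 ≤ m * γ) :
    (m : ℝ) * n / 2 ≤ 12 * n / γ * (16 * (ε * n) ^ 2 +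
        64 * (m * γ) / η * (δ + (m * γ) ^ 2 / n / (ε * n) ^ 2) + 2 * η * (m * γ))
      + 192 * C + 64 * m := by
  classical
  let w : (Fin n → Bool) × (Fin m → (Fin n → Bool) × Option (Fin n)) → ℝ :=
    fun p => setWeight p.1 * ∏ i, siteWeight γ p.1 (p.2 i)
  have hw0 : ∀ p, 0 ≤ w p := fun p => mul_nonneg (setWeight_pos _).le
    (Finset.prod_nonneg fun i _ => siteWeight_nonneg h0.le (by linarith) _ _)
  have hw : ∀ f : (Fin n → Bool) → (Fin m → (Fin n → Bool) × Option (Fin n)) → ℝ,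
      ∑ p, w p * f p.1 p.2 = ∑ y, setWeight y * prodExp (fun _ : Fin m => siteWeight γ y) (f y) := by
    intro f
    rw [Fintype.sum_prod_type]
    refine Finset.sum_congr rfl fun y _ => ?_
    rw [prodExp, Finset.mul_sum]
    exact Finset.sum_congr rfl fun s _ => by simp only [w]; ring
  have hw1 : ∑ p, w p = 1 := by
    have := hw fun _ _ => 1
    simpa only [mul_one, prodExp_const (fun _ : Fin m => sum_siteWeight hn γ _), sum_setWeight]
      using this
  obtain ⟨ω, hω⟩ := exists_average_le P.coins w hw0 hw1
    (fun p => {ω | (P.det ω).out (hardInput N p.1 fun i => plant (p.2 i)) ∉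
      approximations ε (distinctElements (hardInput N p.1 fun i => plant (p.2 i)))}) δ
    (fun p => hP _)
  refine (hardTranscript n N (P.det ω)).cost_bound Prod.snd hn hε h0 h1 hη (fun y X => ?_) ?_ hr hΛ
  · have h2 := Coordinator.sum_length_finalHist
      (fun i => (P.det ω).site i (hardInput N y X i)) (P.det ω).coordinator (fun _ => [])
    rw [Fin.sum_univ_succ] at h2
    have h3 : ((P.det ω).coordinator.run (fun i => (P.det ω).site i (hardInput N y X i))
        fun _ => []).2 ≤ C := hC ω (hardInput N y X)
    have h4 : ∑ i, ((hardTranscript n N (P.det ω)).hist i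
        ((hardTranscript n N (P.det ω)).full y X)).length ≤ C := by
      simp only [hardTranscript]
      simp only [List.length_nil, Finset.sum_const_zero] at h2
      omega
    exact_mod_cast h4
  · rw [← hw fun y s => if |((hardTranscript n N (P.det ω)).run y s).2 -
      numDistinct y (fun i => plant (s i))| ≤ ε * n then 0 else 1]
    refine le_trans (Finset.sum_le_sum fun p _ => mul_le_mul_of_nonneg_left ?_ (hw0 p)) hω
    by_cases hg : (P.det ω).out (hardInput N p.1 fun i => plant (p.2 i)) ∈
        approximations ε (distinctElements (hardInput N p.1 fun i => plant (p.2 i)))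
    · rw [if_pos]
      · exact Set.indicator_nonneg (fun _ _ => zero_le_one) _
      · rw [distinctElements_hardInput hN] at hg
        have hD : numDistinct p.1 (fun i => plant (p.2 i)) ≤ n := by
          rw [numDistinct, Finset.sum_boole]
          exact_mod_cast (Finset.card_le_univ _).trans (Fintype.card_fin n).le
        change |(P.det ω).out (hardInput N p.1 fun i => plant (p.2 i)) - _| ≤ _
        obtain ⟨g1, g2⟩ := hg
        rw [abs_of_nonneg (by linarith)]
        nlinarith
    · rw [Set.indicator_of_mem (by exact hg)]
      split_ifs <;> norm_num

/-- With these parameters the average posterior variance is at most a fraction `3 / 400` of `l * n`,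
the expected number of planted elements: the terms `16 * ν / l`, `2 * η` and the one with the error
probability are at most `1 / 400` each. -/
lemma cost_bound_of_parameters {m n C ε δ l ν : ℝ} (hl : l = 1 / 524288000000)
    (hν : ν = l / 6400) (hn0 : 0 < n) (hm0 : 0 < m) (hn : 1000 ≤ n) (hε : 0 < ε)
    (hδ : δ ≤ 1 / 40960000) (hx1 : ε ^ 2 * n ≤ ν) (hx2 : ν / 2 ≤ ε ^ 2 * n)
    (hbound : m * n / 2 ≤ 12 * n / (l * n / m) * (16 * (ε * n) ^ 2 +
        64 * (l * n) / (1 / 800) * (δ + (l * n) ^ 2 / n / (ε * n) ^ 2) + 2 * (1 / 800) * (l * n))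
      + 192 * C + 64 * m) :
    m * n / 1000 ≤ C := by
  have hl0 : 0 < l := by rw [hl]; norm_num
  have hεn : 0 < ε ^ 2 * n := by positivity
  have e1 : 12 * n / (l * n / m) * (16 * (ε * n) ^ 2 +
      64 * (l * n) / (1 / 800) * (δ + (l * n) ^ 2 / n / (ε * n) ^ 2) + 2 * (1 / 800) * (l * n))
      = 12 * (m * n) * (16 * (ε ^ 2 * n) / l + 51200 * (δ + l ^ 2 / (ε ^ 2 * n)) + 1 / 400) := by
    clear hbound hx1 hx2 hδ hν hl
    field_simp
    ring
  rw [e1] at hbound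
  have e2 : 16 * (ε ^ 2 * n) / l ≤ 1 / 400 := by
    rw [div_le_iff₀ hl0]
    rw [hν] at hx1
    linarith
  have e3 : l ^ 2 / (ε ^ 2 * n) ≤ 1 / 40960000 := by
    rw [div_le_iff₀ hεn]
    have : l ^ 2 = 1 / 40960000 * (ν / 2) := by rw [hν, hl]; norm_num
    rw [this]
    linarith
  have hmn : 0 < m * n := by positivity
  have e4 : 12 * (m * n) * (16 * (ε ^ 2 * n) / l + 51200 * (δ + l ^ 2 / (ε ^ 2 * n)) + 1 / 400)
      ≤ 12 * (m * n) * (3 / 400) :=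
    mul_le_mul_of_nonneg_left (by linarith) (by positivity)
  have e5 : 1000 * m ≤ m * n := by
    rw [mul_comm]
    exact mul_le_mul_of_nonneg_left hn hm0.le
  linarith

theorem theorem3p6 :
    ∃ cβ : ℝ, 1 < cβ ∧ ∃ δ₀ : ℝ, 0 < δ₀ ∧ ∃ cN : ℝ, 0 < cN ∧ ∃ c : ℝ, 0 < c ∧
      ∀ (k N : ℕ) (ε δ : ℝ), 0 < ε → cβ ≤ 1 / ε ^ 2 → 1 / ε ^ 2 ≤ k / cβ →
        cN / ε ^ 2 ≤ N → δ ≤ δ₀ →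
        ∀ P : RandProtocol k (Fin N → ℕ) ℝ, ComputesF0 P ε δ →
          ENNReal.ofReal (c * (k / (ε ^ 2 * Real.logb 2 (ε ^ 2 * k)))) ≤
            ((P.commComplexity : ℕ∞) : ℝ≥0∞) := by
  -- `l = γ * m / n` is the expected number of times that an element is planted, and `ν ≈ ε ^ 2 * n`
  obtain ⟨l, hl⟩ : ∃ l : ℝ, l = 1 / 524288000000 := ⟨_, rfl⟩
  obtain ⟨ν, hν⟩ : ∃ ν : ℝ, ν = l / 6400 := ⟨_, rfl⟩
  have hl0 : 0 < l := by rw [hl]; norm_num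
  have hν0 : 0 < ν := by rw [hν]; positivity
  have hν1 : ν ≤ 1 := by rw [hν, hl]; norm_num
  refine ⟨2000 / (l * ν), ?_, 1 / 40960000, by norm_num, 1, one_pos, ν / 4000, by positivity, ?_⟩
  · rw [hν, hl]; norm_num
  intro k N ε δ hε hβ hk hN hδ P hP
  by_cases hfin : P.commComplexity = ⊤
  · rw [hfin]; simp
  obtain ⟨C, hC⟩ := ENat.ne_top_iff_exists.mp hfin
  rw [← hC]
  have hcost : ∀ ω x, (P.det ω).cost x ≤ C := by
    intro ω x
    have : (((P.det ω).cost x : ℕ) : ℕ∞) ≤ P.commComplexity :=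
      le_iSup_of_le ω (le_iSup_of_le x le_rfl)
    rw [← hC] at this
    exact_mod_cast this
  have hε2 : 0 < ε ^ 2 := by positivity
  have hcβ : (2 : ℝ) ≤ 2000 / (l * ν) := by rw [hν, hl]; norm_num
  have hkε : 1 / ε ^ 2 * 2 ≤ k := by
    have h1 : 1 / ε ^ 2 * (2000 / (l * ν)) ≤ k := by
      rwa [le_div_iff₀ (by positivity)] at hk
    have h2 : 0 < 1 / ε ^ 2 := by positivity
    nlinarith
  have hk2 : (2 : ℝ) ≤ k := by nlinarith
  obtain ⟨m, rfl⟩ : ∃ m, k = m + 1 := ⟨k - 1, by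
    have : 2 ≤ k := by exact_mod_cast hk2
    omega⟩
  have hm1 : (1 : ℝ) ≤ m := by push_cast at hk2; linarith
  have hmk : ((m + 1 : ℕ) : ℝ) / 2 ≤ m := by push_cast; linarith
  have hx : 2000 / l ≤ ν / ε ^ 2 := by
    have := mul_le_mul_of_nonneg_left hβ hν0.le
    have e : ν * (2000 / (l * ν)) = 2000 / l := by field_simp
    rw [e] at this
    calc _ ≤ _ := this
      _ = _ := by ring
  set n := ⌊ν / ε ^ 2⌋₊ with hn
  have hn1 : (n : ℝ) ≤ ν / ε ^ 2 := Nat.floor_le (by positivity)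
  have hn2 : ν / ε ^ 2 < n + 1 := Nat.lt_floor_add_one _
  have hl1 : 1 ≤ 1 / l := by rw [hl]; norm_num
  have e0 : 2000 / l = 2000 * (1 / l) := by ring
  have hn3 : 1000 * (1 / l) ≤ n := by linarith
  have hn4 : ν / ε ^ 2 / 2 ≤ n := by linarith
  have hn0 : (0 : ℝ) < n := by linarith
  have hx1 : ε ^ 2 * n ≤ ν := by
    rw [le_div_iff₀ hε2] at hn1; linarith
  have hx2 : ν / 2 ≤ ε ^ 2 * n := by
    have e : ν / ε ^ 2 / 2 = (ν / 2) / ε ^ 2 := by ring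
    rw [e, div_le_iff₀ hε2] at hn4; linarith
  have hnm : (n : ℝ) ≤ m := by
    have : ν / ε ^ 2 ≤ 1 / ε ^ 2 := by gcongr
    linarith
  have hNn : n ≤ N := by
    have : ν / ε ^ 2 ≤ 1 / ε ^ 2 := by gcongr
    exact_mod_cast (hn1.trans this).trans hN
  have hln : 1000 ≤ l * n := by
    have := mul_le_mul_of_nonneg_left hn3 hl0.le
    have e : l * (1000 * (1 / l)) = 1000 := by field_simp
    linarith
  have hmγ : m * (l * n / m) = l * n := by field_simp
  have hbound := randProtocol_cost_bound (n := n) (γ := l * n / m) (η := 1 / 800) P hP hcost hNn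
    (by exact_mod_cast hn0) hε (by positivity)
    (by
      rw [div_le_iff₀ (by linarith)]
      have : l ≤ 1 / 2 := by rw [hl]; norm_num
      nlinarith)
    (by norm_num)
    (by
      have e : 16 * (ε * n) ^ 2 = 16 * ((ε ^ 2 * n) * n) := by ring
      rw [e]
      have : ν / 2 * n ≤ (ε ^ 2 * n) * n := mul_le_mul_of_nonneg_right hx2 hn0.le
      have e2 : ν / 2 * n = l * n / 12800 := by rw [hν]; ring
      have : 1 ≤ 16 * (l * n / 12800) := by linarith
      linarith)
    (by rw [hmγ]; linarith)
  rw [hmγ] at hbound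
  have hn1000 : (1000 : ℝ) ≤ n := by linarith
  have hmain : (m : ℝ) * n / 1000 ≤ C :=
    cost_bound_of_parameters hl hν hn0 (by linarith) hn1000 hε hδ hx1 hx2 hbound
  -- the logarithm is at least `1`
  have hlog : 1 ≤ Real.logb 2 (ε ^ 2 * (m + 1 : ℕ)) := by
    rw [Real.le_logb_iff_rpow_le (by norm_num) (by positivity), Real.rpow_one]
    rw [div_mul_eq_mul_div, div_le_iff₀ hε2] at hkε
    linarith
  have hfinal : ν / 4000 * ((m + 1 : ℕ) / (ε ^ 2 * Real.logb 2 (ε ^ 2 * (m + 1 : ℕ)))) ≤ C := by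
    have h1 : ((m + 1 : ℕ) : ℝ) / (ε ^ 2 * Real.logb 2 (ε ^ 2 * (m + 1 : ℕ)))
        ≤ (m + 1 : ℕ) / ε ^ 2 := by
      refine div_le_div_of_nonneg_left (by positivity) hε2 ?_
      nlinarith
    have h2 := mul_le_mul_of_nonneg_left h1 (by positivity : 0 ≤ ν / 4000)
    have h3 : ((m + 1 : ℕ) : ℝ) / 2 * (ν / ε ^ 2 / 2) ≤ m * n :=
      mul_le_mul hmk hn4 (by positivity) (by positivity)
    have e : ν / 4000 * (((m + 1 : ℕ) : ℝ) / ε ^ 2)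
        = ((m + 1 : ℕ) : ℝ) / 2 * (ν / ε ^ 2 / 2) / 1000 := by ring
    rw [e] at h2
    linarith
  calc ENNReal.ofReal _ ≤ ENNReal.ofReal (C : ℝ) := ENNReal.ofReal_le_ofReal hfinal
    _ = _ := by rw [ENNReal.ofReal_natCast]; rfl
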